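/- A weighted graph is a finite simple graph $W$ in which every vertex $i$ has a positive integer weight $w(i)$. Its weighted characteristic polynomial is $\phi^*(W,x)=\det(I^*(x)-A(W))$, where $A(W)$ is the adjacency matrix of $W$ and $I^*(x)$ is the diagonal matrix, indexed by the vertices of $W$, with $ii$-entry $x^{w(i)}$. Two weighted graphs are weighted cospectral if they have the same weighted characteristic polynomial. A weighted free tree is a tree with a positive integer weight on each vertex and no distinguished root, considered up to weight-preserving isomorphism; its total weight is the sum of its vertex weights. Theorem. Almost every weighted free tree is weighted cospectral with another weighted free tree. That is, if $t_n$ is the number of weighted free trees of total weight $n$ and $c_n$ is the number of those that are weighted cospectral with some other (non-isomorphic) weighted free tree, then $$\lim_{n\to\infty}\frac{c_n}{t_n}=1.$$ -/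

import Mathlib

open Filter Topology Polynomial

/-- A weighted graph on the vertex set `V`: every vertex has a positive integer weight. -/
structure WeightedGraph (V : Type*) where
  /-- the underlying simple graph -/
  graph : SimpleGraph V
  /-- the vertex weights -/
  weight : V → ℕ
  weight_pos : ∀ v, 0 < weight v

namespace WeightedGraph

/-- Isomorphism of weighted graphs: a graph isomorphism that preserves the weights. -/
def Isomorphic {V V' : Type*} (W : WeightedGraph V) (W' : WeightedGraph V') : Prop :=
  ∃ e : W.graph ≃g W'.graph, ∀ v, W'.weight (e v) = W.weight v

/-- The sum of all vertex weights. -/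
def totalWeight {V : Type*} [Fintype V] (W : WeightedGraph V) : ℕ := ∑ v, W.weight v

open Classical in
/-- The weighted characteristic polynomial `det (I* - A)`, where `I*` is diagonal with entries
`x ^ w(i)` and `A` is the adjacency matrix. -/
noncomputable def charPoly {V : Type*} [Fintype V] (W : WeightedGraph V) : ℤ[X] :=
  (Matrix.diagonal (fun i => (X : ℤ[X]) ^ W.weight i) - W.graph.adjMatrix ℤ[X]).det

theorem Isomorphic.totalWeight_eq {V V' : Type*} [Fintype V] [Fintype V']
    {W : WeightedGraph V} {W' : WeightedGraph V'} (h : W.Isomorphic W') :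
    W.totalWeight = W'.totalWeight := by
  obtain ⟨e, he⟩ := h
  exact Fintype.sum_equiv e.toEquiv _ _ (fun v => (he v).symm)

theorem Isomorphic.charPoly_eq {V V' : Type*} [Fintype V] [Fintype V']
    {W : WeightedGraph V} {W' : WeightedGraph V'} (h : W.Isomorphic W') :
    W.charPoly = W'.charPoly := by
  classical
  obtain ⟨e, he⟩ := h
  unfold charPoly
  rw [← Matrix.det_submatrix_equiv_self e.toEquiv]
  congr 1
  ext1 i j
  have hadj : W'.graph.Adj (e i) (e j) ↔ W.graph.Adj i j := e.map_rel_iff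
  by_cases hij : i = j
  · subst hij
    simp [he]
  · simp [hij, hadj]

end WeightedGraph

/-- A concrete weighted tree, with vertex set `Fin order`. Every finite weighted tree is isomorphic
to one of these. (`SimpleGraph.IsTree` means connected, in particular nonempty, and acyclic.) -/
structure WeightedTree where
  /-- the number of vertices -/
  order : ℕ
  /-- the underlying weighted graph -/
  toGraph : WeightedGraph (Fin order)
  isTree : toGraph.graph.IsTree

/-- Weighted trees up to (weight-preserving) isomorphism. -/
instance WeightedTree.isoSetoid : Setoid WeightedTree where
  r T T' := T.toGraph.Isomorphic T'.toGraph
  iseqv :=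
    { refl := fun _ => ⟨RelIso.refl _, fun _ => rfl⟩
      symm := fun {_ T'} h => by
        obtain ⟨e, he⟩ := h
        refine ⟨e.symm, fun v => ?_⟩
        have := he (e.symm v)
        rw [RelIso.apply_symm_apply] at this
        exact this.symm
      trans := fun {_ _ _} h h' => by
        obtain ⟨e, he⟩ := h
        obtain ⟨e', he'⟩ := h'
        exact ⟨e.trans e', fun v => (he' (e v)).trans (he v)⟩ }

/-- A weighted free tree: an isomorphism class of (unrooted) weighted trees. -/
def WeightedFreeTree : Type := Quotient WeightedTree.isoSetoid

namespace WeightedFreeTree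

/-- The total weight of a weighted free tree. -/
def totalWeight (t : WeightedFreeTree) : ℕ :=
  Quotient.lift (fun T : WeightedTree => T.toGraph.totalWeight)
    (fun _ _ h => WeightedGraph.Isomorphic.totalWeight_eq h) t

/-- The weighted characteristic polynomial of a weighted free tree. -/
noncomputable def charPoly (t : WeightedFreeTree) : ℤ[X] :=
  Quotient.lift (fun T : WeightedTree => T.toGraph.charPoly)
    (fun _ _ h => WeightedGraph.Isomorphic.charPoly_eq h) t

/-- Two weighted free trees are weighted cospectral if they have the same weighted characteristic
polynomial. -/
def Cospectral (s t : WeightedFreeTree) : Prop := s.charPoly = t.charPoly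

/-- The set of weighted free trees of total weight `n`. -/
def ofWeight (n : ℕ) : Set WeightedFreeTree := {t | t.totalWeight = n}

/-- The weighted free trees of total weight `n` that are weighted cospectral with another (that is,
non-isomorphic) weighted free tree. -/
def withMate (n : ℕ) : Set WeightedFreeTree :=
  {t | t ∈ ofWeight n ∧ ∃ s : WeightedFreeTree, s ≠ t ∧ s.Cospectral t}

/-- There are only finitely many weighted free trees of a given total weight, so that the
cardinalities `Set.ncard` of `ofWeight n` and of its subset `withMate n` are the true ones. -/
theorem finite_ofWeight (n : ℕ) : (ofWeight n).Finite := by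
  have key : ∀ T : WeightedTree, T.toGraph.totalWeight = n →
      (∀ v, T.toGraph.weight v ≤ n) ∧ T.order ≤ n := by
    intro T hT
    constructor
    · intro v
      rw [← hT]
      exact Finset.single_le_sum (f := T.toGraph.weight) (fun _ _ => Nat.zero_le _)
        (Finset.mem_univ v)
    · rw [← hT]
      have := Finset.card_nsmul_le_sum Finset.univ T.toGraph.weight 1
        (fun v _ => T.toGraph.weight_pos v)
      simpa [WeightedGraph.totalWeight] using this
  let S : Set WeightedTree := {T | T.toGraph.totalWeight = n}
  let code : S → Σ m : Fin (n + 1), SimpleGraph (Fin m) × (Fin m → Fin (n + 1)) := fun T =>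
    ⟨⟨T.1.order, Nat.lt_succ_of_le (key T.1 T.2).2⟩, T.1.toGraph.graph,
      fun v => ⟨T.1.toGraph.weight v, Nat.lt_succ_of_le ((key T.1 T.2).1 v)⟩⟩
  have hinj : Function.Injective code := by
    rintro ⟨⟨m, ⟨G, w, hw⟩, hT⟩, h⟩ ⟨⟨m', ⟨G', w', hw'⟩, hT'⟩, h'⟩ heq
    have hm : m = m' := congrArg (fun c => (c.1 : ℕ)) heq
    subst hm
    simp only [code, Sigma.mk.injEq, heq_eq_eq, true_and, Prod.mk.injEq] at heq
    obtain ⟨rfl, h2⟩ := heq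
    have : w = w' := funext fun v => congrArg Fin.val (congrFun h2 v)
    subst this
    rfl
  have hS : S.Finite := Finite.of_injective code hinj
  refine (hS.image (fun T => (Quotient.mk _ T : WeightedFreeTree))).subset ?_
  intro t ht
  induction t using Quotient.inductionOn with
  | h T => exact ⟨T, ht, rfl⟩

end WeightedFreeTree

/-! ### Matula codes of rooted weighted trees -/

namespace MatulaCode

open Nat (primeCounting' nth primeFactorsList)

/-! Pendant paths at a vertex `v` enter the characteristic determinant only through the product of
their own determinants and the sum of their Schur complement terms at `v` (`PendantPaths.det_eq`).
Write a path as (weight next to `v`, weight of the leaf). The triples (2,1), (4,2), (1,5) and (5,1),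
(2,4), (1,2) give the same product and, by `sum_pathWeight`, the same sum, so exchanging them
preserves the polynomial. The exchange yields a different tree, since it destroys a leaf of weight 1
hanging on a vertex of weight 2 and creates none. It remains to show that almost every tree carries
the first triple at some vertex.

Rooted weighted trees correspond to positive integers: a root of weight `w` whose branches have
codes `c` gets the code `2 ^ (w - 1)` times the product of the primes `nth Nat.Prime c`. A vertex
carries the triple of branches as soon as its code is divisible by `q = limbCode`, so a tree without
a mate avoids `q` at every node, whatever its root.

By unique factorization the generating function `T_q` of the trees avoiding `q` has an Euler
product, that is, `T_q = R_q * exp (T_q + tail)`, where the root factor `R_q` is explicit and the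
tail is controlled by the generating function at `x ^ 2`, hence finite beyond the radius `ρ < 1` of
the series `T_0` of all trees. As `t * exp (-t)` is largest at `t = 1`, `T_0 (ρ) ≤ 1`; and `T_q (ρ)
< T_0 (ρ)`, because the tree `q` itself is missing. Below 1 the equation leaves room, so `T_q` still
converges a little beyond `ρ` (`exists_radius_lt_summable`). Approximate supermultiplicativity of
the number of all codes bounds it below at every `n` (`exists_le_card_avoiding_zero`), so codes
avoiding `q` are exponentially rare. A free tree of weight `n` has at most `n` rootings, and this
factor `n` is harmless. -/

theorem primeCounting'_lt_of_mem {k p : ℕ} (h : p ∈ primeFactorsList k) : primeCounting' p < k := by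
  have hp := Nat.prime_of_mem_primeFactorsList h
  have h1 := Nat.add_two_le_nth_prime (primeCounting' p)
  have h2 : nth Nat.Prime (primeCounting' p) = p := Nat.nth_count hp
  have := Nat.le_of_mem_primeFactorsList h
  omega

theorem nth_primeCounting' {p : ℕ} (hp : p.Prime) : nth Nat.Prime (primeCounting' p) = p :=
  Nat.nth_count hp

theorem primeCounting'_two : primeCounting' 2 = 0 := by decide

theorem nth_prime_zero : nth Nat.Prime 0 = 2 := by
  have := nth_primeCounting' Nat.prime_two
  rwa [primeCounting'_two] at this

theorem nth_prime_inj {i j : ℕ} : nth Nat.Prime i = nth Nat.Prime j ↔ i = j :=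
  (Nat.nth_injective Nat.infinite_setOfPred_prime).eq_iff

theorem primeCounting'_eq_zero {p : ℕ} (hp : p.Prime) : primeCounting' p = 0 ↔ p = 2 := by
  rw [← nth_prime_inj, nth_primeCounting' hp, nth_prime_zero]

theorem lt_nth_prime (i : ℕ) : i < nth Nat.Prime i := by
  have := Nat.add_two_le_nth_prime i
  omega

/-- The total weight of the rooted weighted tree with Matula code `k`: the multiplicity of the
prime `2` is one less than the weight of the root, and a factor `nth Nat.Prime c` with `0 < c`
stands for a child whose subtree has code `c`. -/
noncomputable def treeSize (k : ℕ) : ℕ :=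
  1 + ((primeFactorsList k).attach.map fun p => treeSize (primeCounting' p.1)).sum
termination_by k
decreasing_by exact primeCounting'_lt_of_mem p.2

theorem treeSize_eq (k : ℕ) :
    treeSize k = 1 + ((primeFactorsList k).map fun p => treeSize (primeCounting' p)).sum := by
  rw [treeSize, ← List.attach_map_subtype_val (primeFactorsList k), List.map_map,
    List.attach_map_subtype_val]
  rfl

theorem treeSize_pos (k : ℕ) : 0 < treeSize k := by
  rw [treeSize_eq]; omega

theorem treeSize_zero : treeSize 0 = 1 := by
  rw [treeSize_eq]; simp

theorem treeSize_one : treeSize 1 = 1 := by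
  rw [treeSize_eq]; simp

theorem treeSize_mul {a b : ℕ} (ha : a ≠ 0) (hb : b ≠ 0) :
    treeSize (a * b) + 1 = treeSize a + treeSize b := by
  rw [treeSize_eq, treeSize_eq a, treeSize_eq b,
    ((Nat.perm_primeFactorsList_mul ha hb).map _).sum_eq]
  simp
  omega

theorem treeSize_nth_prime (c : ℕ) : treeSize (nth Nat.Prime c) = 1 + treeSize c := by
  rw [treeSize_eq, Nat.primeFactorsList_prime (Nat.prime_nth_prime c)]
  simp [Nat.primeCounting'_nth_eq]

/-- No node of the rooted tree with code `k` has a code divisible by `q`. -/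
def Avoids (q k : ℕ) : Prop :=
  ¬ q ∣ k ∧ ∀ p, (h : p ∈ primeFactorsList k) → p = 2 ∨ Avoids q (primeCounting' p)
termination_by k
decreasing_by exact primeCounting'_lt_of_mem h

theorem avoids_iff {q k : ℕ} :
    Avoids q k ↔ ¬ q ∣ k ∧ ∀ p ∈ primeFactorsList k, p = 2 ∨ Avoids q (primeCounting' p) := by
  rw [Avoids]

theorem not_avoids_zero (q : ℕ) : ¬ Avoids q 0 := by
  rw [avoids_iff]; simp

/-- Codes strictly decrease towards the leaves, so none reaches `q`. Since `0` divides only `0`,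
avoiding `0` is no restriction beyond being nonzero: the case `q = 0` counts all trees. -/
theorem avoids_of_ne_zero {q : ℕ} : ∀ {k : ℕ}, k ≠ 0 → (q = 0 ∨ k < q) → Avoids q k := by
  intro k
  induction k using Nat.strong_induction_on with
  | _ k ih =>
    intro hk hq
    rw [avoids_iff]
    constructor
    · intro h
      have := Nat.le_of_dvd (Nat.pos_of_ne_zero hk) h
      rcases hq with rfl | hq
      · exact hk (zero_dvd_iff.1 h)
      · omega
    · intro p hp
      by_cases h2 : p = 2
      · exact Or.inl h2
      · have hlt := primeCounting'_lt_of_mem hp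
        refine Or.inr (ih _ hlt ?_ (by omega))
        rwa [Ne, primeCounting'_eq_zero (Nat.prime_of_mem_primeFactorsList hp)]

/-! ### The Euler product of the tree generating function -/

/-- The completely multiplicative function with value `g i` at the `i`-th prime. -/
noncomputable def primeExt (g : ℕ → ℝ) : ℕ →* ℝ where
  toFun k := if k = 0 then 0 else ((primeFactorsList k).map fun p => g (primeCounting' p)).prod
  map_one' := by simp
  map_mul' a b := by
    by_cases ha : a = 0
    · simp [ha]
    by_cases hb : b = 0
    · simp [hb]
    simp only [ha, hb, mul_eq_zero, or_self, if_false]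
    rw [((Nat.perm_primeFactorsList_mul ha hb).map _).prod_eq, List.map_append, List.prod_append]

theorem primeExt_apply (g : ℕ → ℝ) {k : ℕ} (hk : k ≠ 0) :
    primeExt g k = ((primeFactorsList k).map fun p => g (primeCounting' p)).prod :=
  if_neg hk

theorem primeExt_zero (g : ℕ → ℝ) : primeExt g 0 = 0 := by
  simp [primeExt]

theorem primeExt_prime (g : ℕ → ℝ) {p : ℕ} (hp : p.Prime) :
    primeExt g p = g (primeCounting' p) := by
  rw [primeExt_apply g hp.ne_zero, Nat.primeFactorsList_prime hp]
  simp

theorem primesBelow_nth_prime (M : ℕ) :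
    (nth Nat.Prime M).primesBelow = (Finset.range M).image (nth Nat.Prime) := by
  ext p
  simp only [Nat.mem_primesBelow, Finset.mem_image, Finset.mem_range]
  constructor
  · rintro ⟨h, hp⟩
    refine ⟨primeCounting' p, ?_, nth_primeCounting' hp⟩
    rw [← nth_primeCounting' hp] at h
    exact (Nat.nth_lt_nth Nat.infinite_setOfPred_prime).1 h
  · rintro ⟨i, hi, rfl⟩
    exact ⟨(Nat.nth_lt_nth Nat.infinite_setOfPred_prime).2 hi, Nat.prime_nth_prime i⟩

theorem hasSum_primeExt {g : ℕ → ℝ} (hg : ∀ i, |g i| < 1) (M : ℕ) :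
    HasSum (fun m : (nth Nat.Prime M).smoothNumbers => primeExt g m)
      (∏ j ∈ Finset.range M, (1 - g j)⁻¹) := by
  have h := (EulerProduct.summable_and_hasSum_smoothNumbers_prod_primesBelow_geometric
    (f := primeExt g) (fun {p} hp => by
      rw [primeExt_prime g hp, Real.norm_eq_abs]; exact hg _) (nth Nat.Prime M)).2
  rw [primesBelow_nth_prime, Finset.prod_image
    (fun a _ b _ h => (Nat.nth_injective Nat.infinite_setOfPred_prime) h)] at h
  simpa only [primeExt_prime g (Nat.prime_nth_prime _), Nat.primeCounting'_nth_eq] using h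

theorem mem_smoothNumbers_of_le {k M : ℕ} (hk : k ≠ 0) (h : k ≤ M) :
    k ∈ (nth Nat.Prime M).smoothNumbers := by
  rw [Nat.mem_smoothNumbers]
  refine ⟨hk, fun p hp => ?_⟩
  have := Nat.le_of_mem_primeFactorsList hp
  have := lt_nth_prime M
  omega

open Classical in
/-- The term of the tree `k` in the generating function, by total weight, of the trees
avoiding `q`. -/
noncomputable def term (q : ℕ) (x : ℝ) (k : ℕ) : ℝ := if Avoids q k then x ^ treeSize k else 0

/-- `term`, with value `x` at `0`, the index of the prime `2` that encodes the root weight. -/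
noncomputable def primeTerm (q : ℕ) (x : ℝ) (k : ℕ) : ℝ := if k = 0 then x else term q x k

theorem term_zero (q : ℕ) (x : ℝ) : term q x 0 = 0 := if_neg (not_avoids_zero q)

theorem term_nonneg (q : ℕ) {x : ℝ} (hx : 0 ≤ x) (k : ℕ) : 0 ≤ term q x k := by
  unfold term; split_ifs <;> positivity

theorem term_le (q : ℕ) {x : ℝ} (hx : 0 ≤ x) (hx1 : x ≤ 1) (k : ℕ) : term q x k ≤ x := by
  unfold term; split_ifs
  · exact pow_le_of_le_one hx hx1 (treeSize_pos k).ne'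
  · exact hx

theorem primeTerm_eq {q : ℕ} (x : ℝ) {p : ℕ} (hp : p.Prime)
    (h : p = 2 ∨ Avoids q (primeCounting' p)) :
    primeTerm q x (primeCounting' p) = x ^ treeSize (primeCounting' p) := by
  by_cases h2 : p = 2
  · rw [h2, primeCounting'_two, treeSize_zero, primeTerm, if_pos rfl, pow_one]
  · rw [primeTerm, if_neg (by rwa [primeCounting'_eq_zero hp]), term, if_pos (h.resolve_left h2)]

/-- `treeSize k - 1` is additive over the prime factors of `k`; the missing 1 is the unit of weight
that every root has. -/
theorem primeExt_primeTerm {q : ℕ} (x : ℝ) {k : ℕ} (hk : k ≠ 0)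
    (h : ∀ p ∈ primeFactorsList k, p = 2 ∨ Avoids q (primeCounting' p)) :
    primeExt (primeTerm q x) k = x ^ (treeSize k - 1) := by
  rw [primeExt_apply _ hk, treeSize_eq, Nat.add_sub_cancel_left]
  have hp : ∀ p ∈ primeFactorsList k, p.Prime := fun p hp => Nat.prime_of_mem_primeFactorsList hp
  generalize primeFactorsList k = l at h hp
  induction l with
  | nil => simp
  | cons p l ih =>
    rw [List.map_cons, List.prod_cons, List.map_cons, List.sum_cons, pow_add,
      primeTerm_eq x (hp p List.mem_cons_self) (h p List.mem_cons_self),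
      ih (fun p hp => h p (List.mem_cons_of_mem _ hp)) (fun p h => hp p (List.mem_cons_of_mem _ h))]

/-- If some branch fails to avoid `q`, its factor `primeTerm` vanishes and kills the product, so
only divisibility at the root remains to be tested. -/
theorem term_eq {q : ℕ} (x : ℝ) {k : ℕ} (hk : k ≠ 0) :
    term q x k = if q ∣ k then 0 else x * primeExt (primeTerm q x) k := by
  classical
  by_cases hq : q ∣ k
  · rw [if_pos hq, term, if_neg]
    rw [avoids_iff]
    exact fun h => h.1 hq
  rw [if_neg hq, term]
  by_cases h : Avoids q k
  · rw [if_pos h, primeExt_primeTerm x hk (avoids_iff.1 h).2, ← pow_succ',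
      Nat.sub_add_cancel (treeSize_pos k)]
  · rw [if_neg h, primeExt_apply _ hk]
    rw [avoids_iff] at h
    push Not at h
    obtain ⟨p, hp, h2, hA⟩ := h hq
    rw [eq_comm, mul_eq_zero, List.prod_eq_zero_iff, List.mem_map]
    refine Or.inr ⟨p, hp, ?_⟩
    rw [primeTerm, if_neg, term, if_neg hA]
    rwa [primeCounting'_eq_zero (Nat.prime_of_mem_primeFactorsList hp)]

/-- The factor of the root in the generating function of the trees avoiding `q`. -/
noncomputable def rootFactor (q : ℕ) (x : ℝ) : ℝ :=
  x * (1 - if q = 0 then 0 else x ^ (treeSize q - 1)) / (1 - x)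

theorem primeExt_self {q : ℕ} (x : ℝ) :
    primeExt (primeTerm q x) q = if q = 0 then 0 else x ^ (treeSize q - 1) := by
  split_ifs with h
  · rw [h, primeExt_zero]
  · refine primeExt_primeTerm x h fun p hp => ?_
    by_cases h2 : p = 2
    · exact Or.inl h2
    · refine Or.inr (avoids_of_ne_zero ?_ (Or.inr (primeCounting'_lt_of_mem hp)))
      rwa [Ne, primeCounting'_eq_zero (Nat.prime_of_mem_primeFactorsList hp)]

/-- The sum of a completely multiplicative function over all smooth numbers, minus its sum over the
multiples of `q`. The bound `q ≤ M` makes `q` itself smooth, and `0 < M` puts the prime `2` among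
the factors. -/
theorem hasSum_term {q : ℕ} {x : ℝ} (hx : 0 ≤ x) (hx1 : x < 1) {M : ℕ} (hM : 0 < M) (hq : q ≤ M) :
    HasSum (fun m : (nth Nat.Prime M).smoothNumbers => term q x m)
      (rootFactor q x * ∏ j ∈ Finset.range M, (1 - term q x j)⁻¹) := by
  have hg : ∀ i, |primeTerm q x i| < 1 := by
    intro i
    unfold primeTerm
    split_ifs
    · rwa [abs_of_nonneg hx]
    · rw [abs_of_nonneg (term_nonneg q hx i)]
      exact (term_le q hx hx1.le i).trans_lt hx1
  set f := primeExt (primeTerm q x) with hf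
  set P := ∏ j ∈ Finset.range M, (1 - primeTerm q x j)⁻¹ with hP
  have h1 : HasSum (fun m : (nth Nat.Prime M).smoothNumbers => f m) P := hasSum_primeExt hg M
  have h2 : HasSum (fun m : (nth Nat.Prime M).smoothNumbers => if q ∣ (m : ℕ) then f m else 0)
      (f q * P) := by
    by_cases hq0 : q = 0
    · have : ∀ m : (nth Nat.Prime M).smoothNumbers, (if q ∣ (m : ℕ) then f m else 0) = 0 := by
        intro m
        rw [if_neg]
        rw [hq0, zero_dvd_iff]
        exact Nat.ne_zero_of_mem_smoothNumbers m.2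
      have h0 : f q * P = 0 := by rw [hq0, hf, primeExt_zero, zero_mul]
      rw [h0, funext this]
      exact hasSum_zero
    -- Multiplication by `q` maps the smooth numbers bijectively onto the smooth multiples of `q`,
    -- which extracts the factor `f q`.
    · let i : (nth Nat.Prime M).smoothNumbers → (nth Nat.Prime M).smoothNumbers := fun m =>
        ⟨q * m, Nat.mul_mem_smoothNumbers (mem_smoothNumbers_of_le hq0 hq) m.2⟩
      have hi : Function.Injective i := by
        intro a b hab
        have : q * (a : ℕ) = q * b := congrArg Subtype.val hab
        exact Subtype.ext (Nat.eq_of_mul_eq_mul_left (Nat.pos_of_ne_zero hq0) this)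
      rw [← hi.hasSum_iff]
      · have h := h1.mul_left (f q)
        have e : ((fun m : (nth Nat.Prime M).smoothNumbers => if q ∣ (m : ℕ) then f m else 0) ∘ i)
            = fun m : (nth Nat.Prime M).smoothNumbers => f q * f m := by
          funext m
          simp [i, map_mul]
        rwa [e]
      · intro m hm
        rw [if_neg]
        rintro ⟨c, hc⟩
        refine hm ⟨⟨c, ?_⟩, Subtype.ext hc.symm⟩
        exact Nat.mem_smoothNumbers_of_dvd m.2 (hc ▸ Dvd.intro_left q rfl)
  have h3 := (h1.sub h2).mul_left x
  -- The two products differ only at index `0`, where `primeTerm` is `x` (root weight) and `term` is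
  -- `0`; the factor `(1 - x)⁻¹` goes into `rootFactor`.
  have h4 : P = (1 - x)⁻¹ * ∏ j ∈ Finset.range M, (1 - term q x j)⁻¹ := by
    obtain ⟨N, rfl⟩ := Nat.exists_eq_succ_of_ne_zero hM.ne'
    rw [hP, Finset.prod_range_succ', Finset.prod_range_succ', term_zero]
    simp [primeTerm, mul_comm]
  have h5 : ∀ m : (nth Nat.Prime M).smoothNumbers,
      x * (f m - if q ∣ (m : ℕ) then f m else 0) = term q x m := by
    intro m
    rw [term_eq x (Nat.ne_zero_of_mem_smoothNumbers m.2)]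
    split_ifs <;> simp [hf]
  have h6 : x * (P - f q * P)
      = rootFactor q x * ∏ j ∈ Finset.range M, (1 - term q x j)⁻¹ := by
    rw [h4, hf, primeExt_self, rootFactor]
    ring
  rw [funext h5, h6] at h3
  exact h3

/-- Every nonzero `k ≤ M` is smooth, as `M < nth Nat.Prime M`. The left side reaches one index
further than the product, which is what allows induction on `M`. -/
theorem sum_term_le {q : ℕ} {x : ℝ} (hx : 0 ≤ x) (hx1 : x < 1) {M : ℕ} (hM : 0 < M) (hq : q ≤ M) :
    ∑ k ∈ Finset.range (M + 1), term q x k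
      ≤ rootFactor q x * ∏ j ∈ Finset.range M, (1 - term q x j)⁻¹ := by
  have h := (hasSum_subtype_iff_indicator (f := term q x)
    (s := (nth Nat.Prime M).smoothNumbers)).1 (hasSum_term (q := q) hx hx1 hM hq)
  refine (Finset.sum_le_sum fun k hk => ?_).trans (sum_le_hasSum (Finset.range (M + 1)) ?_ h)
  · by_cases hk0 : k = 0
    · rw [hk0, term_zero]
      exact Set.indicator_nonneg (fun k _ => term_nonneg q hx k) _
    · rw [Set.indicator_of_mem]
      exact mem_smoothNumbers_of_le hk0 (by simpa [Nat.lt_succ_iff] using hk)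
  · exact fun k _ => Set.indicator_nonneg (fun k _ => term_nonneg q hx k) _

theorem le_tsum_term {q : ℕ} {x : ℝ} (hx : 0 ≤ x) (hx1 : x < 1) (hs : Summable (term q x))
    {M : ℕ} (hM : 0 < M) (hq : q ≤ M) :
    rootFactor q x * ∏ j ∈ Finset.range M, (1 - term q x j)⁻¹ ≤ ∑' k, term q x k := by
  rw [← (hasSum_term hx hx1 hM hq).tsum_eq]
  exact hs.tsum_subtype_le _ _ (term_nonneg q hx)

end MatulaCode

namespace MatulaCode

open Nat (primeCounting' nth primeFactorsList)

/-! ### Radii of convergence -/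

theorem neg_log_one_sub_sub_nonneg {t : ℝ} (ht : t < 1) : 0 ≤ -Real.log (1 - t) - t := by
  have := Real.log_le_sub_one_of_pos (sub_pos.2 ht)
  linarith

theorem neg_log_one_sub_le {t x : ℝ} (ht : 0 ≤ t) (htx : t ≤ x) (hx : x < 1) :
    -Real.log (1 - t) ≤ t / (1 - x) := by
  have h1 : 0 < 1 - t := by linarith
  rw [← Real.log_inv]
  refine (Real.log_le_sub_one_of_pos (inv_pos.2 h1)).trans ?_
  have : (1 - t)⁻¹ - 1 = t / (1 - t) := by field_simp; ring
  rw [this]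
  exact div_le_div_of_nonneg_left ht (by linarith) (by linarith)

theorem neg_log_one_sub_sub_le {t x : ℝ} (ht : 0 ≤ t) (htx : t ≤ x) (hx : x < 1) :
    -Real.log (1 - t) - t ≤ t ^ 2 / (1 - x) := by
  have h1 : 0 < 1 - t := by linarith
  have h2 := neg_log_one_sub_le ht le_rfl (htx.trans_lt hx)
  have h3 : t / (1 - t) - t = t ^ 2 / (1 - t) := by field_simp; ring
  have h4 : t ^ 2 / (1 - t) ≤ t ^ 2 / (1 - x) :=
    div_le_div_of_nonneg_left (sq_nonneg t) (by linarith) (by linarith)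
  linarith

theorem term_sq (q : ℕ) (x : ℝ) (k : ℕ) : term q x k ^ 2 = term q (x ^ 2) k := by
  unfold term
  split_ifs
  · rw [← pow_mul, ← pow_mul, mul_comm]
  · simp

theorem term_mono (q : ℕ) {x y : ℝ} (hx : 0 ≤ x) (hxy : x ≤ y) (k : ℕ) :
    term q x k ≤ term q y k := by
  unfold term
  split_ifs
  · exact pow_le_pow_left₀ hx hxy _
  · exact le_rfl

theorem term_le_term_zero (q : ℕ) {x : ℝ} (hx : 0 ≤ x) (k : ℕ) : term q x k ≤ term 0 x k := by
  by_cases h : Avoids q k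
  · have hk : k ≠ 0 := by
      rintro rfl
      exact not_avoids_zero q h
    rw [term, if_pos h, term, if_pos (avoids_of_ne_zero hk (Or.inl rfl))]
  · rw [term, if_neg h]
    exact term_nonneg 0 hx k

/-- The part of `-log (1 - t)` of order at least two, at `t = term q x k`. -/
noncomputable def logTail (q : ℕ) (x : ℝ) (k : ℕ) : ℝ :=
  -Real.log (1 - term q x k) - term q x k

section
variable {q : ℕ} {x : ℝ}

theorem logTail_nonneg (hx : 0 ≤ x) (hx1 : x < 1) (k : ℕ) : 0 ≤ logTail q x k :=
  neg_log_one_sub_sub_nonneg ((term_le q hx hx1.le k).trans_lt hx1)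

/-- The tail has order two, so it is summable as soon as the series converges at `x ^ 2`, which can
happen beyond the radius. -/
theorem logTail_le (hx : 0 ≤ x) (hx1 : x < 1) (k : ℕ) :
    logTail q x k ≤ term q (x ^ 2) k / (1 - x) := by
  rw [← term_sq]
  exact neg_log_one_sub_sub_le (term_nonneg q hx k) (term_le q hx hx1.le k) hx1

theorem summable_logTail (hx : 0 ≤ x) (hx1 : x < 1) (hs : Summable (term q (x ^ 2))) :
    Summable (logTail q x) :=
  Summable.of_nonneg_of_le (logTail_nonneg hx hx1) (logTail_le hx hx1) (hs.div_const _)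

theorem prod_inv_eq_exp (hx : 0 ≤ x) (hx1 : x < 1) (M : ℕ) :
    ∏ j ∈ Finset.range M, (1 - term q x j)⁻¹
      = Real.exp (∑ j ∈ Finset.range M, term q x j + ∑ j ∈ Finset.range M, logTail q x j) := by
  rw [← Finset.sum_add_distrib, Real.exp_sum]
  refine Finset.prod_congr rfl fun j _ => ?_
  have : 0 < 1 - term q x j := sub_pos.2 ((term_le q hx hx1.le j).trans_lt hx1)
  rw [logTail, add_sub_cancel, Real.exp_neg, Real.exp_log this]

theorem rootFactor_nonneg (hx : 0 ≤ x) (hx1 : x < 1) : 0 ≤ rootFactor q x := by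
  unfold rootFactor
  refine div_nonneg (mul_nonneg hx ?_) (by linarith)
  split_ifs
  · norm_num
  · exact sub_nonneg.2 (pow_le_one₀ hx hx1.le)

theorem Summable.sq (hx : 0 ≤ x) (hx1 : x < 1) (hs : Summable (term q x)) :
    Summable (term q (x ^ 2)) :=
  Summable.of_nonneg_of_le (term_nonneg q (sq_nonneg x))
    (fun k => term_mono q (sq_nonneg x) (by nlinarith) k) hs

/-- A supersolution of the functional equation bounds the generating function. -/
theorem sum_term_le_of_supersolution {y : ℝ} (hx : 0 ≤ x) (hx1 : x < 1)
    (hs : Summable (logTail q x)) (h0 : ∑ k ∈ Finset.range (q + 1), term q x k ≤ y)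
    (hy : rootFactor q x * Real.exp (y + ∑' k, logTail q x k) ≤ y) (N : ℕ) :
    ∑ k ∈ Finset.range N, term q x k ≤ y := by
  have key : ∀ M, ∑ k ∈ Finset.range (q + 1 + M), term q x k ≤ y := by
    intro M
    induction M with
    | zero => exact h0
    | succ M ih =>
      -- The bound on the terms below `q + 1 + M` controls the product, and the product controls one
      -- more term.
      refine (sum_term_le hx hx1 (M := q + 1 + M) (by omega) (by omega)).trans (le_trans ?_ hy)
      rw [prod_inv_eq_exp hx hx1]
      refine mul_le_mul_of_nonneg_left (Real.exp_le_exp.2 (add_le_add ih ?_))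
        (rootFactor_nonneg hx hx1)
      exact hs.sum_le_tsum _ fun k _ => logTail_nonneg hx hx1 k
  refine le_trans (Finset.sum_le_sum_of_subset_of_nonneg ?_ fun k _ _ => term_nonneg q hx k) (key N)
  exact Finset.range_subset_range.2 (by omega)

/-- One half of the functional equation, obtained by letting `M` grow in `le_tsum_term`; the other
half is replaced by the supersolution argument. -/
theorem rootFactor_mul_exp_le (hx : 0 ≤ x) (hx1 : x < 1) (hs : Summable (term q x)) :
    rootFactor q x * Real.exp (∑' k, term q x k + ∑' k, logTail q x k) ≤ ∑' k, term q x k := by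
  have h := summable_logTail hx hx1 (Summable.sq hx hx1 hs)
  have ht : Tendsto (fun M => rootFactor q x * Real.exp (∑ j ∈ Finset.range M, term q x j
      + ∑ j ∈ Finset.range M, logTail q x j)) atTop
      (𝓝 (rootFactor q x * Real.exp (∑' k, term q x k + ∑' k, logTail q x k))) :=
    ((Real.continuous_exp.tendsto _).comp
      (hs.hasSum.tendsto_sum_nat.add h.hasSum.tendsto_sum_nat)).const_mul _
  refine le_of_tendsto ht ?_
  filter_upwards [eventually_ge_atTop (q + 1)] with M hM
  rw [← prod_inv_eq_exp hx hx1]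
  exact le_tsum_term hx hx1 hs (by omega) (by omega)

/-- If `C * exp Y ≤ Y`, then `C ≤ Y * exp (-Y) ≤ exp (-1)`, so `C * exp 1 ≤ 1`: the number 1 is a
supersolution and bounds the sum. -/
theorem tsum_term_zero_le_one (hx : 0 ≤ x) (hx1 : x < 1) (hs : Summable (term 0 x)) :
    ∑' k, term 0 x k ≤ 1 := by
  have h := rootFactor_mul_exp_le hx hx1 hs
  have hT := summable_logTail hx hx1 (Summable.sq hx hx1 hs)
  refine hs.tsum_le_of_sum_range_le
    (sum_term_le_of_supersolution hx hx1 hT ?_ ?_)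
  · simp [term_zero]
  · set Y := ∑' k, term 0 x k
    have h1 : Real.exp (1 + ∑' k, logTail 0 x k)
        = Real.exp (Y + ∑' k, logTail 0 x k) * Real.exp (1 - Y) := by
      rw [← Real.exp_add]; ring_nf
    rw [h1, ← mul_assoc]
    refine (mul_le_mul_of_nonneg_right h (Real.exp_pos _).le).trans ?_
    have h2 : Y ≤ Real.exp (Y - 1) := by linarith [Real.add_one_le_exp (Y - 1)]
    refine (mul_le_mul_of_nonneg_right h2 (Real.exp_pos _).le).trans ?_
    rw [← Real.exp_add]
    simp

/-- At `1 / 10` the root factor is `1 / 9`. If the partial sum is at most 1, the product is at most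
`exp 2 ≤ 9`, so the next partial sum is at most 1 again. -/
theorem summable_term_zero_tenth : Summable (term 0 (1 / 10)) := by
  have hx : (0 : ℝ) ≤ 1 / 10 := by norm_num
  have hx1 : (1 / 10 : ℝ) < 1 := by norm_num
  refine summable_of_sum_range_le (c := 1) (term_nonneg 0 hx) fun N => ?_
  induction N with
  | zero => simp
  | succ M ih =>
    rcases Nat.eq_zero_or_pos M with rfl | hM
    · simp [term_zero]
    refine (sum_term_le hx hx1 hM (Nat.zero_le M)).trans ?_
    have h1 : ∏ j ∈ Finset.range M, (1 - term 0 (1 / 10) j)⁻¹ ≤ Real.exp 2 := by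
      rw [prod_inv_eq_exp hx hx1, Real.exp_le_exp, ← Finset.sum_add_distrib]
      have : ∀ j ∈ Finset.range M, term 0 (1 / 10) j + logTail 0 (1 / 10) j
          ≤ term 0 (1 / 10) j * 2 := by
        intro j _
        have := neg_log_one_sub_le (term_nonneg 0 hx j) (term_le 0 hx hx1.le j) hx1
        have h0 := term_nonneg 0 hx j
        rw [logTail]
        have : term 0 (1 / 10) j / (1 - 1 / 10) ≤ term 0 (1 / 10) j * 2 := by
          rw [div_le_iff₀ (by norm_num)]; linarith
        linarith
      refine (Finset.sum_le_sum this).trans ?_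
      rw [← Finset.sum_mul]
      linarith
    have h2 : Real.exp 2 ≤ 9 := by
      have h3 : Real.exp 2 = Real.exp 1 ^ 2 := by rw [← Real.exp_nat_mul]; norm_num
      rw [h3]
      nlinarith [Real.exp_one_lt_d9, Real.exp_pos 1]
    have h3 : rootFactor 0 (1 / 10) = 1 / 9 := by norm_num [rootFactor]
    rw [h3]
    linarith

theorem treeSize_two : treeSize 2 = 2 := by
  have := treeSize_nth_prime 0
  rwa [nth_prime_zero, treeSize_zero] at this

theorem lt_of_summable_term_zero (hx : 0 ≤ x) (hx1 : x < 1) (hs : Summable (term 0 x)) :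
    x < 9 / 10 := by
  have h := (hs.sum_le_tsum (Finset.range 3) fun k _ => term_nonneg 0 hx k).trans
    (tsum_term_zero_le_one hx hx1 hs)
  rw [Finset.sum_range_succ, Finset.sum_range_succ, Finset.sum_range_one, term_zero, term,
    if_pos (avoids_of_ne_zero one_ne_zero (Or.inl rfl)), term,
    if_pos (avoids_of_ne_zero two_ne_zero (Or.inl rfl)), treeSize_one, treeSize_two] at h
  -- The codes `1` and `2` contribute `x + x ^ 2`, which exceeds 1 from `9 / 10` on.
  nlinarith

end

/-- The radius of convergence of the generating function of rooted weighted trees. -/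
noncomputable def radius : ℝ := sSup {x | 0 ≤ x ∧ x < 1 ∧ Summable (term 0 x)}

theorem bddAbove_summable : BddAbove {x | 0 ≤ x ∧ x < 1 ∧ Summable (term 0 x)} :=
  ⟨1, fun _ h => h.2.1.le⟩

theorem nonempty_summable : {x | 0 ≤ x ∧ x < 1 ∧ Summable (term 0 x)}.Nonempty :=
  ⟨1 / 10, by norm_num, by norm_num, summable_term_zero_tenth⟩

theorem tenth_le_radius : 1 / 10 ≤ radius :=
  le_csSup bddAbove_summable ⟨by norm_num, by norm_num, summable_term_zero_tenth⟩

theorem radius_pos : 0 < radius := lt_of_lt_of_le (by norm_num) tenth_le_radius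

theorem radius_lt_one : radius < 1 := by
  refine lt_of_le_of_lt (b := 9 / 10) (csSup_le nonempty_summable ?_) (by norm_num)
  exact fun x h => (lt_of_summable_term_zero h.1 h.2.1 h.2.2).le

theorem summable_of_lt_radius {x : ℝ} (hx : 0 ≤ x) (h : x < radius) : Summable (term 0 x) := by
  obtain ⟨y, hy, hxy⟩ := exists_lt_of_lt_csSup nonempty_summable h
  exact Summable.of_nonneg_of_le (term_nonneg 0 hx) (term_mono 0 hx hxy.le) hy.2.2

theorem not_summable_of_radius_lt {x : ℝ} (h : radius < x) (hx1 : x < 1) :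
    ¬ Summable (term 0 x) := fun hs =>
  absurd (le_csSup bddAbove_summable ⟨radius_pos.le.trans h.le, hx1, hs⟩) (not_le.2 h)

theorem continuous_term (q k : ℕ) : Continuous fun x => term q x k := by
  unfold term
  split_ifs <;> fun_prop

theorem sum_term_radius_le_one (N : ℕ) : ∑ k ∈ Finset.range N, term 0 radius k ≤ 1 := by
  have hc : Continuous fun x => ∑ k ∈ Finset.range N, term 0 x k :=
    continuous_finsetSum _ fun k _ => continuous_term 0 k
  refine le_of_tendsto ((hc.tendsto radius).mono_left (nhdsWithin_le_nhds (s := Set.Iio radius))) ?_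
  filter_upwards [self_mem_nhdsWithin, mem_nhdsWithin_of_mem_nhds (lt_mem_nhds radius_pos)]
    with x hx hx0
  have hx0' : 0 ≤ x := le_of_lt hx0
  have hs := summable_of_lt_radius hx0' hx
  exact (hs.sum_le_tsum _ fun k _ => term_nonneg 0 hx0' k).trans
    (tsum_term_zero_le_one hx0' (lt_trans hx radius_lt_one) hs)

theorem summable_radius : Summable (term 0 radius) :=
  summable_of_sum_range_le (term_nonneg 0 radius_pos.le) sum_term_radius_le_one

/-- The code `q` contributes to the series of all trees but not to that of the trees avoiding `q`.
-/
theorem tsum_radius_lt_one {q : ℕ} (hq : q ≠ 0) : ∑' k, term q radius k < 1 := by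
  have h1 : ∑' k, term 0 radius k ≤ 1 :=
    summable_radius.tsum_le_of_sum_range_le sum_term_radius_le_one
  refine lt_of_lt_of_le ?_ h1
  refine Summable.tsum_lt_tsum (i := q) (term_le_term_zero q radius_pos.le) ?_
    (Summable.of_nonneg_of_le (term_nonneg q radius_pos.le)
      (term_le_term_zero q radius_pos.le) summable_radius) summable_radius
  rw [term, if_neg, term, if_pos (avoids_of_ne_zero hq (Or.inl rfl))]
  · exact pow_pos radius_pos _
  · rw [avoids_iff]
    exact fun h => h.1 dvd_rfl

theorem continuousAt_tsum_logTail (q : ℕ) :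
    ContinuousAt (fun x => ∑' k, logTail q x k) radius := by
  -- Since `radius < 1`, some `z` beyond the radius still has its square below it; on `[0, z]` the
  -- tails are dominated by the convergent series at `z ^ 2`.
  obtain ⟨z, ⟨hz1, hz2⟩, hz⟩ : ∃ z, (z < 1 ∧ z ^ 2 < radius) ∧ radius < z := by
    have h1 : ∀ᶠ z in 𝓝 radius, z < 1 := gt_mem_nhds radius_lt_one
    have h2 : ∀ᶠ z in 𝓝 radius, z ^ 2 < radius :=
      ((continuous_pow 2).tendsto radius).eventually_lt_const
        (by nlinarith [radius_pos, radius_lt_one])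
    have h3 : ∀ᶠ z in 𝓝[>] radius, (z < 1 ∧ z ^ 2 < radius) ∧ radius < z :=
      ((h1.and h2).filter_mono nhdsWithin_le_nhds).and self_mem_nhdsWithin
    exact h3.exists
  have hz0 : 0 ≤ z := radius_pos.le.trans hz.le
  have hs : Summable fun k => term 0 (z ^ 2) k / (1 - z) :=
    (summable_of_lt_radius (sq_nonneg z) hz2).div_const _
  refine (continuousOn_tsum (s := Set.Icc 0 z) (fun k => ?_) hs fun k x hx => ?_).continuousAt
    (Icc_mem_nhds radius_pos hz)
  · unfold logTail
    refine ((ContinuousOn.log ?_ fun x hx => ?_).neg).sub (continuous_term q k).continuousOn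
    · exact (continuous_const.sub (continuous_term q k)).continuousOn
    · have := term_le q hx.1 (hx.2.trans hz1.le) k
      have := hx.2
      exact (sub_pos.2 (by linarith)).ne'
  · have hx1 := hx.2.trans_lt hz1
    rw [Real.norm_eq_abs, abs_of_nonneg (logTail_nonneg hx.1 hx1 k)]
    refine (logTail_le hx.1 hx1 k).trans ?_
    refine div_le_div₀ (term_nonneg 0 (sq_nonneg z) k) ?_ (by linarith) (by linarith [hx.2])
    exact (term_le_term_zero q (sq_nonneg x) k).trans
      (term_mono 0 (sq_nonneg x) (pow_le_pow_left₀ hx.1 hx.2 2) k)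

theorem continuousAt_rootFactor (q : ℕ) : ContinuousAt (rootFactor q) radius := by
  unfold rootFactor
  refine ContinuousAt.div ?_ (by fun_prop) (sub_pos.2 radius_lt_one).ne'
  split_ifs <;> fun_prop

/-- The trees avoiding `q ≠ 0` have a larger radius of convergence than all trees. -/
theorem exists_radius_lt_summable {q : ℕ} (hq : q ≠ 0) :
    ∃ x, radius < x ∧ x < 1 ∧ Summable (term q x) := by
  have hsq : Summable (term q radius) := Summable.of_nonneg_of_le (term_nonneg q radius_pos.le)
    (term_le_term_zero q radius_pos.le) summable_radius
  set a := ∑' k, term q radius k with ha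
  have ha1 : a < 1 := tsum_radius_lt_one hq
  have ha0 : 0 ≤ a := tsum_nonneg (term_nonneg q radius_pos.le)
  obtain ⟨y, hay, hy1⟩ := exists_between ha1
  have h1 : rootFactor q radius * Real.exp (y + ∑' k, logTail q radius k) < y := by
    have h := rootFactor_mul_exp_le radius_pos.le radius_lt_one hsq
    rw [← ha] at h
    have e : Real.exp (y + ∑' k, logTail q radius k)
        = Real.exp (a + ∑' k, logTail q radius k) * Real.exp (y - a) := by
      rw [← Real.exp_add]; ring_nf
    rw [e, ← mul_assoc]
    refine (mul_le_mul_of_nonneg_right h (Real.exp_pos _).le).trans_lt ?_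
    -- Strict increase of `t * exp (-t)` below 1: `y * (1 + a - y) - a = (y - a) * (1 - y) > 0`.
    have h2 : a < y * Real.exp (a - y) := by
      have := Real.add_one_lt_exp (x := a - y) (by linarith)
      nlinarith
    calc a * Real.exp (y - a) < y * Real.exp (a - y) * Real.exp (y - a) :=
          mul_lt_mul_of_pos_right h2 (Real.exp_pos _)
      _ = y := by rw [mul_assoc, ← Real.exp_add]; simp
  have hc1 : ContinuousAt (fun x => rootFactor q x * Real.exp (y + ∑' k, logTail q x k)) radius :=
    (continuousAt_rootFactor q).mul
      (Real.continuous_exp.continuousAt.comp (continuousAt_const.add (continuousAt_tsum_logTail q)))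
  have hc2 : Continuous fun x => ∑ k ∈ Finset.range (q + 1), term q x k :=
    continuous_finsetSum _ fun k _ => continuous_term q k
  have e1 : ∀ᶠ x in 𝓝 radius, rootFactor q x * Real.exp (y + ∑' k, logTail q x k) < y :=
    hc1.eventually_lt_const h1
  have e2 : ∀ᶠ x in 𝓝 radius, ∑ k ∈ Finset.range (q + 1), term q x k < y :=
    hc2.continuousAt.eventually_lt_const
      ((hsq.sum_le_tsum _ fun k _ => term_nonneg q radius_pos.le k).trans_lt hay)
  have e3 : ∀ᶠ x in 𝓝 radius, x < 1 := gt_mem_nhds radius_lt_one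
  have e4 : ∀ᶠ x in 𝓝 radius, x ^ 2 < radius :=
    ((continuous_pow 2).tendsto radius).eventually_lt_const
      (by nlinarith [radius_pos, radius_lt_one])
  have e5 := ((e1.and (e2.and (e3.and e4))).filter_mono nhdsWithin_le_nhds).and
    (self_mem_nhdsWithin (a := radius) (s := Set.Ioi radius))
  obtain ⟨x, ⟨hx1, hx2, hx3, hx4⟩, hx5⟩ := e5.exists
  have hx5 : radius < x := hx5
  have hx0 : 0 ≤ x := radius_pos.le.trans hx5.le
  have hT : Summable (logTail q x) := summable_logTail hx0 hx3
    (Summable.of_nonneg_of_le (term_nonneg q (sq_nonneg x)) (term_le_term_zero q (sq_nonneg x))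
      (summable_of_lt_radius (sq_nonneg x) hx4))
  exact ⟨x, hx5, hx3, summable_of_sum_range_le (term_nonneg q hx0)
    (sum_term_le_of_supersolution hx0 hx3 hT hx2.le hx1.le)⟩

end MatulaCode

namespace MatulaCode

open Nat (primeCounting' nth primeFactorsList)

/-! ### Counting codes by total weight -/

/-- Each such code has the term `(1 / 10) ^ n` in a convergent series. -/
theorem finite_avoids (q n : ℕ) : {k | Avoids q k ∧ treeSize k = n}.Finite := by
  have hs : Summable (term q (1 / 10)) := Summable.of_nonneg_of_le
    (term_nonneg q (by norm_num)) (term_le_term_zero q (by norm_num)) summable_term_zero_tenth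
  have h := hs.tendsto_cofinite_zero.eventually_lt_const
    (show (0 : ℝ) < (1 / 10) ^ n by positivity)
  rw [Filter.eventually_cofinite] at h
  refine h.subset fun k hk => ?_
  rw [Set.mem_ofPred_eq, term, if_pos hk.1, hk.2]
  exact lt_irrefl _

/-- The codes of total weight `n` of trees that avoid `q`. -/
noncomputable def avoiding (q n : ℕ) : Finset ℕ := (finite_avoids q n).toFinset

theorem mem_avoiding {q n k : ℕ} : k ∈ avoiding q n ↔ Avoids q k ∧ treeSize k = n := by
  simp [avoiding]

theorem avoids_zero_iff {k : ℕ} : Avoids 0 k ↔ k ≠ 0 :=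
  ⟨fun h hk => not_avoids_zero 0 (hk ▸ h), fun h => avoids_of_ne_zero h (Or.inl rfl)⟩

theorem mem_avoiding_zero {n k : ℕ} : k ∈ avoiding 0 n ↔ k ≠ 0 ∧ treeSize k = n := by
  rw [mem_avoiding, avoids_zero_iff]

theorem card_avoiding_mul_pow_le {q : ℕ} {x : ℝ} (hx : 0 ≤ x) (hs : Summable (term q x)) (n : ℕ) :
    (avoiding q n).card * x ^ n ≤ ∑' k, term q x k := by
  refine le_trans (le_of_eq ?_) (hs.sum_le_tsum (avoiding q n) fun k _ => term_nonneg q hx k)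
  rw [← nsmul_eq_mul, ← Finset.sum_const]
  refine Finset.sum_congr rfl fun k hk => ?_
  rw [mem_avoiding] at hk
  rw [term, if_pos hk.1, hk.2]

theorem treeSize_two_pow (n : ℕ) : treeSize (2 ^ n) = n + 1 := by
  induction n with
  | zero => exact treeSize_one
  | succ n ih =>
    have := treeSize_mul (pow_ne_zero n two_ne_zero) two_ne_zero
    rw [ih, treeSize_two, ← pow_succ] at this
    omega

theorem card_avoiding_zero_pos {n : ℕ} (hn : 0 < n) : 0 < (avoiding 0 n).card := by
  refine Finset.card_pos.2 ⟨2 ^ (n - 1), mem_avoiding_zero.2 ⟨by positivity, ?_⟩⟩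
  rw [treeSize_two_pow]
  omega

/-- Join two trees under a new root of weight one. The unordered pair of branches is recovered by
unique factorization, whence the factor 2. -/
theorem card_avoiding_zero_mul_le (m n : ℕ) :
    (avoiding 0 m).card * (avoiding 0 n).card ≤ 2 * (avoiding 0 (m + n + 1)).card := by
  rw [← Finset.card_product]
  refine Finset.card_le_mul_card_image_of_maps_to
    (f := fun p : ℕ × ℕ => nth Nat.Prime p.1 * nth Nat.Prime p.2) ?_ 2 ?_
  · rintro ⟨i, j⟩ h
    rw [Finset.mem_product, mem_avoiding_zero, mem_avoiding_zero] at h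
    have hi := (Nat.prime_nth_prime i).ne_zero
    have hj := (Nat.prime_nth_prime j).ne_zero
    rw [mem_avoiding_zero]
    refine ⟨mul_ne_zero hi hj, ?_⟩
    have := treeSize_mul hi hj
    rw [treeSize_nth_prime, treeSize_nth_prime] at this
    simp only at h ⊢
    omega
  · intro b _
    rcases Finset.eq_empty_or_nonempty
      {p ∈ avoiding 0 m ×ˢ avoiding 0 n | nth Nat.Prime p.1 * nth Nat.Prime p.2 = b} with h | h
    · rw [h]; simp
    obtain ⟨⟨i, j⟩, h⟩ := h
    rw [Finset.mem_filter] at h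
    refine (Finset.card_le_card (t := {(i, j), (j, i)}) ?_).trans Finset.card_le_two
    rintro ⟨c, d⟩ hcd
    rw [Finset.mem_filter] at hcd
    have e : nth Nat.Prime c * nth Nat.Prime d = nth Nat.Prime i * nth Nat.Prime j :=
      hcd.2.trans h.2.symm
    have hc := Nat.prime_nth_prime c
    have hd : nth Nat.Prime c ∣ nth Nat.Prime i * nth Nat.Prime j := ⟨_, e.symm⟩
    rw [Finset.mem_insert, Finset.mem_singleton, Prod.mk.injEq, Prod.mk.injEq]
    rcases (Nat.Prime.dvd_mul hc).1 hd with h1 | h1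
    · rw [Nat.prime_dvd_prime_iff_eq hc (Nat.prime_nth_prime i)] at h1
      rw [h1] at e
      have := Nat.eq_of_mul_eq_mul_left (Nat.prime_nth_prime i).pos e
      exact Or.inl ⟨nth_prime_inj.1 h1, nth_prime_inj.1 this⟩
    · rw [Nat.prime_dvd_prime_iff_eq hc (Nat.prime_nth_prime j)] at h1
      rw [h1, mul_comm (nth Nat.Prime i)] at e
      have := Nat.eq_of_mul_eq_mul_left (Nat.prime_nth_prime j).pos e
      exact Or.inr ⟨nth_prime_inj.1 h1, nth_prime_inj.1 this⟩

/-- Otherwise the counts are at most `2 / x ^ (m + 1)`, and comparison with a geometric series gives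
convergence strictly between `radius` and `x`. -/
theorem exists_two_lt {x : ℝ} (hx : radius < x) (hx1 : x < 1) :
    ∃ m, 2 < (avoiding 0 m).card * x ^ (m + 1) := by
  by_contra! hcon
  obtain ⟨z, hz, hzx⟩ := exists_between hx
  have hz0 : 0 < z := radius_pos.trans hz
  have hx0 : 0 < x := hz0.trans hzx
  refine not_summable_of_radius_lt hz (hzx.trans hx1) ?_
  have hgeo : Summable fun m : ℕ => 2 / x * (z / x) ^ m :=
    (summable_geometric_of_lt_one (by positivity) ((div_lt_one hx0).2 hzx)).mul_left _
  refine summable_of_sum_range_le (c := ∑' m : ℕ, 2 / x * (z / x) ^ m)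
    (term_nonneg 0 hz0.le) fun N => ?_
  have hmap : ∀ k ∈ Finset.range N, treeSize k ∈ (Finset.range N).image treeSize :=
    fun k hk => Finset.mem_image_of_mem _ hk
  rw [← Finset.sum_fiberwise_of_maps_to hmap]
  refine (Finset.sum_le_sum fun m _ => ?_).trans
    (hgeo.sum_le_tsum ((Finset.range N).image treeSize) fun m _ => by positivity)
  calc ∑ k ∈ Finset.range N with treeSize k = m, term 0 z k
      ≤ ∑ k ∈ avoiding 0 m, z ^ m := by
        rw [← Finset.sum_filter_add_sum_filter_not _ (fun k => k ≠ 0)]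
        have h0 : ∑ k ∈ {k ∈ Finset.range N | treeSize k = m} with ¬ k ≠ 0, term 0 z k = 0 := by
          refine Finset.sum_eq_zero fun k hk => ?_
          rw [Finset.mem_filter, not_not] at hk
          rw [hk.2, term_zero]
        rw [h0, add_zero]
        refine (Finset.sum_le_sum (g := fun _ => z ^ m) fun k hk => ?_).trans
          (Finset.sum_le_sum_of_subset_of_nonneg (fun k hk => ?_) fun _ _ _ => by positivity)
        · rw [Finset.mem_filter, Finset.mem_filter] at hk
          rw [term, if_pos (avoids_zero_iff.2 hk.2), hk.1.2]
        · rw [Finset.mem_filter, Finset.mem_filter] at hk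
          exact mem_avoiding_zero.2 ⟨hk.2, hk.1.2⟩
    _ = (avoiding 0 m).card * x ^ (m + 1) * (1 / x * (z / x) ^ m) := by
        rw [Finset.sum_const, nsmul_eq_mul, div_pow, pow_succ]
        field_simp
    _ ≤ 2 * (1 / x * (z / x) ^ m) := mul_le_mul_of_nonneg_right (hcon m) (by positivity)
    _ = 2 / x * (z / x) ^ m := by ring

/-- With `m` from `exists_two_lt`, joining a fixed-size tree of weight `m` to one of weight `l`
shows that the normalized count at `m + l + 1` is at least the one at `l`. Descending in steps of `m
+ 1` leads to some `n ≤ m + 1`, where there is at least one tree. -/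
theorem exists_le_card_avoiding_zero {x : ℝ} (hx : radius < x) (hx1 : x < 1) :
    ∃ c > 0, ∀ n, 0 < n → c ≤ (avoiding 0 n).card * x ^ n := by
  obtain ⟨m, hm⟩ := exists_two_lt hx hx1
  have hx0 : 0 < x := radius_pos.trans hx
  refine ⟨x ^ (m + 1), by positivity, fun n => ?_⟩
  induction n using Nat.strong_induction_on with
  | _ n ih =>
    intro hn
    by_cases hnm : n ≤ m + 1
    · have h1 : (1 : ℝ) ≤ (avoiding 0 n).card := by
        exact_mod_cast card_avoiding_zero_pos hn
      calc x ^ (m + 1) ≤ x ^ n := pow_le_pow_of_le_one hx0.le hx1.le hnm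
        _ = 1 * x ^ n := (one_mul _).symm
        _ ≤ _ := mul_le_mul_of_nonneg_right h1 (by positivity)
    · obtain ⟨l, rfl⟩ : ∃ l, n = m + l + 1 := ⟨n - m - 1, by omega⟩
      refine (ih l (by omega) (by omega)).trans ?_
      have h : ((avoiding 0 m).card : ℝ) * (avoiding 0 l).card
          ≤ 2 * (avoiding 0 (m + l + 1)).card := by
        exact_mod_cast card_avoiding_zero_mul_le m l
      have h2 : (0 : ℝ) ≤ (avoiding 0 l).card * x ^ l := by positivity
      have h3 : x ^ (m + l + 1) = x ^ (m + 1) * x ^ l := by rw [← pow_add]; ring_nf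
      have h4 := mul_le_mul_of_nonneg_right h (show 0 ≤ x ^ (m + l + 1) by positivity)
      have h5 := mul_le_mul_of_nonneg_right hm.le h2
      rw [h3] at h4 ⊢
      nlinarith

/-- Codes avoiding `q` are rare, even after multiplication by the total weight. -/
theorem tendsto_card_avoiding_div {q : ℕ} (hq : q ≠ 0) :
    Tendsto (fun n : ℕ => n * ((avoiding q n).card : ℝ) / (avoiding 0 n).card) atTop (𝓝 0) := by
  obtain ⟨y, hy, hy1, hs⟩ := exists_radius_lt_summable hq
  obtain ⟨x, hx, hxy⟩ := exists_between hy
  obtain ⟨c, hc, hcn⟩ := exists_le_card_avoiding_zero hx (hxy.trans hy1)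
  have hx0 : 0 < x := radius_pos.trans hx
  have hy0 : 0 < y := hx0.trans hxy
  set A := ∑' k, term q y k
  have hA : 0 ≤ A := tsum_nonneg (term_nonneg q hy0.le)
  have ht : Tendsto (fun n : ℕ => A / c * (n * (x / y) ^ n)) atTop (𝓝 0) := by
    have := (tendsto_self_mul_const_pow_of_lt_one (r := x / y) (by positivity)
      ((div_lt_one hy0).2 hxy)).const_mul (A / c)
    simpa using this
  refine squeeze_zero' (Eventually.of_forall fun n => by positivity) ?_ ht
  filter_upwards [eventually_gt_atTop 0] with n hn
  have h1 := card_avoiding_mul_pow_le hy0.le hs n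
  have h2 := hcn n hn
  have h3 : (0 : ℝ) < (avoiding 0 n).card := by exact_mod_cast card_avoiding_zero_pos hn
  have h4 : ((avoiding q n).card : ℝ) ≤ A / y ^ n := by rwa [le_div_iff₀ (by positivity)]
  rw [div_le_iff₀ h3]
  calc n * ((avoiding q n).card : ℝ) ≤ n * (A / y ^ n) := by gcongr
    _ = n * (A / y ^ n) / c * c := by field_simp
    _ ≤ n * (A / y ^ n) / c * ((avoiding 0 n).card * x ^ n) := by gcongr
    _ = A / c * (n * (x / y) ^ n) * (avoiding 0 n).card := by rw [div_pow]; ring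

end MatulaCode

/-! ### Rooted trees given by parent functions -/

/-- A weighted tree with a root, presented by the parent of every vertex; the root is its own
parent. -/
structure Arbor (V : Type*) where
  /-- the root -/
  root : V
  /-- the parent of a vertex -/
  par : V → V
  /-- the distance from the root -/
  depth : V → ℕ
  /-- the vertex weights -/
  weight : V → ℕ
  par_root : par root = root
  depth_root : depth root = 0
  depth_par : ∀ v, v ≠ root → depth v = depth (par v) + 1
  weight_pos : ∀ v, 0 < weight v

namespace Arbor

open MatulaCode
open Nat (nth)

section
variable {V : Type*} (a : Arbor V)

theorem depth_eq_zero {v : V} : a.depth v = 0 ↔ v = a.root := by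
  refine ⟨fun h => ?_, fun h => h ▸ a.depth_root⟩
  by_contra hv
  have := a.depth_par v hv
  omega

theorem par_ne {v : V} (hv : v ≠ a.root) : a.par v ≠ v := by
  intro h
  have := a.depth_par v hv
  rw [h] at this
  omega

/-- The underlying weighted graph: every vertex but the root is adjacent to its parent. -/
def toGraph : WeightedGraph V where
  graph :=
    { Adj := fun u v => u ≠ v ∧ (a.par u = v ∨ a.par v = u)
      symm := ⟨fun _ _ h => ⟨h.1.symm, h.2.symm⟩⟩
      loopless := ⟨fun _ h => h.1 rfl⟩ }
  weight := a.weight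
  weight_pos := a.weight_pos

theorem adj_iff {u v : V} : a.toGraph.graph.Adj u v ↔ u ≠ v ∧ (a.par u = v ∨ a.par v = u) :=
  Iff.rfl

theorem adj_par {v : V} (hv : v ≠ a.root) : a.toGraph.graph.Adj v (a.par v) :=
  ⟨(a.par_ne hv).symm, Or.inl rfl⟩

/-- Induction from the root. -/
theorem par_induction {P : V → Prop} (h0 : P a.root)
    (h : ∀ v, v ≠ a.root → P (a.par v) → P v) (v : V) : P v := by
  induction hn : a.depth v generalizing v with
  | zero => rwa [a.depth_eq_zero.1 hn]
  | succ n ih =>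
    have hv : v ≠ a.root := by
      rintro rfl
      rw [a.depth_root] at hn
      omega
    have := a.depth_par v hv
    exact h v hv (ih _ (by omega))

/-- Sending a vertex to the edge to its parent matches the vertices other than the root with the
edges. -/
theorem isTree [Finite V] : a.toGraph.graph.IsTree := by
  classical
  have := Fintype.ofFinite V
  have hc : ∀ v, a.toGraph.graph.Reachable v a.root := fun v =>
    a.par_induction (P := fun v => a.toGraph.graph.Reachable v a.root) (SimpleGraph.Reachable.refl _)
      (fun v hv ih => (a.adj_par hv).reachable.trans ih) v
  rw [SimpleGraph.isTree_iff_connected_and_card]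
  refine ⟨@SimpleGraph.Connected.mk _ _ (fun u v => (hc u).trans (hc v).symm) ⟨a.root⟩, ?_⟩
  have e : {v // v ≠ a.root} ≃ a.toGraph.graph.edgeSet := by
    refine Equiv.ofBijective (fun v => ⟨s(v.1, a.par v.1), a.adj_par v.2⟩) ⟨?_, ?_⟩
    · rintro ⟨u, hu⟩ ⟨v, hv⟩ h
      have h' : s(u, a.par u) = s(v, a.par v) := congrArg Subtype.val h
      rw [Sym2.eq_iff] at h'
      rcases h' with h' | ⟨h1, h2⟩
      · exact Subtype.ext h'.1
      · have h3 := a.depth_par u hu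
        have h4 := a.depth_par v hv
        rw [h2] at h3
        rw [← h1] at h4
        omega
    · rintro ⟨s, hs⟩
      induction s using Sym2.ind with
      | _ u v =>
        rw [SimpleGraph.mem_edgeSet] at hs
        obtain ⟨hne, h | h⟩ := hs
        · refine ⟨⟨u, ?_⟩, Subtype.ext ?_⟩
          · rintro rfl
            exact hne (a.par_root.symm.trans h)
          · simp [h]
        · refine ⟨⟨v, ?_⟩, Subtype.ext ?_⟩
          · rintro rfl
            exact hne.symm (a.par_root.symm.trans h)
          · simp [h, Sym2.eq_swap]
  rw [← Nat.card_congr e]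
  have h := Fintype.card_subtype_compl (fun v => v = a.root)
  rw [Fintype.card_subtype_eq] at h
  have hpos : 0 < Fintype.card V := Fintype.card_pos_iff.2 ⟨a.root⟩
  rw [Nat.card_eq_fintype_card, Nat.card_eq_fintype_card]
  change Fintype.card {v // ¬ v = a.root} + 1 = _
  omega

theorem exists_of_isTree (W : WeightedGraph V) (hW : W.graph.IsTree) (r : V) :
    ∃ a : Arbor V, a.root = r ∧ a.toGraph = W := by
  classical
  have hex : ∀ v, v ≠ r → ∃ u, W.graph.Adj v u ∧ W.graph.dist r v = W.graph.dist r u + 1 := by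
    intro v hv
    obtain ⟨p, hp⟩ := hW.connected.exists_walk_length_eq_dist v r
    cases p with
    | nil => exact absurd rfl hv
    | @cons _ u _ h q =>
      refine ⟨u, h, ?_⟩
      rw [SimpleGraph.Walk.length_cons, SimpleGraph.dist_comm] at hp
      have h1 := SimpleGraph.dist_le q
      rw [SimpleGraph.dist_comm] at h1
      rcases hW.dist_eq_dist_add_one_of_adj r h with h2 | h2 <;> omega
  -- Two neighbours of `v` nearer to `r` would give two geodesics from `v` to `r`, but paths in a
  -- tree are unique.
  have huniq : ∀ v u u', W.graph.Adj v u → W.graph.dist r v = W.graph.dist r u + 1 →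
      W.graph.Adj v u' → W.graph.dist r v = W.graph.dist r u' + 1 → u = u' := by
    intro v u u' h1 h2 h3 h4
    obtain ⟨p, hp⟩ := hW.connected.exists_walk_length_eq_dist u r
    obtain ⟨p', hp'⟩ := hW.connected.exists_walk_length_eq_dist u' r
    rw [SimpleGraph.dist_comm (v := r)] at hp hp'
    have e1 : (SimpleGraph.Walk.cons h1 p).IsPath :=
      SimpleGraph.Walk.isPath_of_length_eq_dist _ (by
        rw [SimpleGraph.Walk.length_cons, hp, SimpleGraph.dist_comm (u := v), h2])
    have e2 : (SimpleGraph.Walk.cons h3 p').IsPath :=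
      SimpleGraph.Walk.isPath_of_length_eq_dist _ (by
        rw [SimpleGraph.Walk.length_cons, hp', SimpleGraph.dist_comm (u := v), h4])
    have := congrArg Subtype.val ((hW.isAcyclic.subsingleton_path v r).elim ⟨_, e1⟩ ⟨_, e2⟩)
    injection this
  choose! p hp using hex
  refine ⟨⟨r, fun v => if v = r then r else p v, W.graph.dist r, W.weight, if_pos rfl,
    SimpleGraph.dist_self, fun v hv => ?_, W.weight_pos⟩, rfl, ?_⟩
  · simp only [if_neg hv]
    exact (hp v hv).2
  · have hpar : ∀ u v, (u ≠ v ∧ (if u = r then r else p u) = v) ↔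
        W.graph.Adj u v ∧ W.graph.dist r u = W.graph.dist r v + 1 := by
      intro u v
      by_cases hu : u = r
      · subst hu
        simp only [if_true, SimpleGraph.dist_self]
        constructor
        · exact fun h => absurd h.2 h.1
        · rintro ⟨_, h⟩
          omega
      · rw [if_neg hu]
        constructor
        · rintro ⟨_, rfl⟩
          exact hp u hu
        · intro h
          exact ⟨h.1.ne, huniq u _ _ (hp u hu).1 (hp u hu).2 h.1 h.2⟩
    obtain ⟨G, w, hw⟩ := W
    simp only [toGraph, WeightedGraph.mk.injEq, and_true]
    ext u v
    simp only
    rw [and_or_left, hpar u v, ne_comm, hpar v u, G.adj_comm v u]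
    constructor
    · rintro (h | h) <;> exact h.1
    · intro h
      rcases hW.dist_eq_dist_add_one_of_adj r h with h' | h'
      · exact Or.inl ⟨h, h'⟩
      · exact Or.inr ⟨h, h'⟩

end

/-! ### The code of a rooted weighted tree -/

section
variable {V : Type*} [Fintype V] (a : Arbor V)

open Classical in
/-- The children of a vertex. -/
noncomputable def children (v : V) : Finset V := {u | u ≠ a.root ∧ a.par u = v}

theorem mem_children {u v : V} : u ∈ a.children v ↔ u ≠ a.root ∧ a.par u = v := by
  simp [children]

theorem depth_of_mem_children {u v : V} (h : u ∈ a.children v) : a.depth u = a.depth v + 1 := by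
  rw [mem_children] at h
  rw [a.depth_par u h.1, h.2]

theorem sup_depth_sub_lt {u v : V} (h : u ∈ a.children v) :
    Finset.univ.sup a.depth - a.depth u < Finset.univ.sup a.depth - a.depth v := by
  have h1 := a.depth_of_mem_children h
  have h2 : a.depth u ≤ Finset.univ.sup a.depth := Finset.le_sup (Finset.mem_univ u)
  omega

/-- Induction towards the root. -/
theorem children_induction {P : V → Prop} (h : ∀ v, (∀ u ∈ a.children v, P u) → P v) (v : V) :
    P v := by
  induction hn : Finset.univ.sup a.depth - a.depth v using Nat.strong_induction_on generalizing v
    with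
  | _ n ih =>
    exact h v fun u hu => ih _ (hn ▸ a.sup_depth_sub_lt hu) u rfl

/-- The Matula code of the subtree below a vertex. -/
noncomputable def code (v : V) : ℕ :=
  2 ^ (a.weight v - 1) * ∏ u : {u // u ∈ a.children v}, nth Nat.Prime (code u.1)
termination_by Finset.univ.sup a.depth - a.depth v
decreasing_by exact a.sup_depth_sub_lt u.2

theorem code_eq (v : V) :
    a.code v = 2 ^ (a.weight v - 1) * ∏ u ∈ a.children v, nth Nat.Prime (a.code u) := by
  rw [code, ← Finset.prod_coe_sort (a.children v) fun u => nth Nat.Prime (a.code u)]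

/-- The recursion determines the code, so codes of transported or newly built trees are found by
exhibiting a solution. -/
theorem eq_code {c : V → ℕ}
    (hc : ∀ v, c v = 2 ^ (a.weight v - 1) * ∏ u ∈ a.children v, nth Nat.Prime (c u)) (v : V) :
    c v = a.code v := by
  refine a.children_induction (P := fun v => c v = a.code v) (fun v ih => ?_) v
  rw [hc, code_eq]
  congr 1
  exact Finset.prod_congr rfl fun u hu => by rw [ih u hu]

theorem code_ne_zero (v : V) : a.code v ≠ 0 := by
  rw [code_eq]
  exact mul_ne_zero (by positivity)
    (Finset.prod_ne_zero_iff.2 fun u _ => (Nat.prime_nth_prime _).ne_zero)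

theorem treeSize_code (v : V) :
    treeSize (a.code v) = a.weight v + ∑ u ∈ a.children v, treeSize (a.code u) := by
  have hprod : ∀ s : Finset V, treeSize (∏ u ∈ s, nth Nat.Prime (a.code u))
      = 1 + ∑ u ∈ s, treeSize (a.code u) := by
    classical
    intro s
    induction s using Finset.induction_on with
    | empty => simp [treeSize_one]
    | insert u s hu ih =>
      have := treeSize_mul (Nat.prime_nth_prime (a.code u)).ne_zero
        (Finset.prod_ne_zero_iff.2 fun v (_ : v ∈ s) => (Nat.prime_nth_prime (a.code v)).ne_zero)
      rw [ih, treeSize_nth_prime] at this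
      rw [Finset.prod_insert hu, Finset.sum_insert hu]
      omega
  have h := treeSize_mul (pow_ne_zero (a.weight v - 1) two_ne_zero)
    (Finset.prod_ne_zero_iff.2 fun u (_ : u ∈ a.children v) =>
      (Nat.prime_nth_prime (a.code u)).ne_zero)
  rw [← code_eq, treeSize_two_pow, hprod] at h
  have := a.weight_pos v
  omega

/-- Sum the recursion over all vertices: every vertex except the root is a child exactly once, so
all sizes but the root's cancel. -/
theorem treeSize_code_root : treeSize (a.code a.root) = a.toGraph.totalWeight := by
  classical
  have h1 : ∑ v, treeSize (a.code v)
      = ∑ v, a.weight v + ∑ v, ∑ u ∈ a.children v, treeSize (a.code u) := by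
    rw [← Finset.sum_add_distrib]
    exact Finset.sum_congr rfl fun v _ => a.treeSize_code v
  have h2 : ∑ v, ∑ u ∈ a.children v, treeSize (a.code u)
      = ∑ u ∈ Finset.univ.erase a.root, treeSize (a.code u) := by
    rw [← Finset.sum_fiberwise_of_maps_to (s := Finset.univ.erase a.root) (t := Finset.univ)
      (g := a.par) (fun _ _ => Finset.mem_univ _)]
    refine Finset.sum_congr rfl fun v _ => Finset.sum_congr ?_ fun _ _ => rfl
    ext u
    simp [mem_children]
  rw [h2, ← Finset.add_sum_erase _ _ (Finset.mem_univ a.root)] at h1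
  change _ = ∑ v, a.weight v
  omega

/-- A child contributes its prime to the code. -/
theorem factorization_code_nth_prime (v : V) {c : ℕ} (hc : c ≠ 0) :
    (a.code v).factorization (nth Nat.Prime c)
      = ((a.children v).filter fun u => a.code u = c).card := by
  rw [code_eq, Nat.factorization_mul (by positivity)
    (Finset.prod_ne_zero_iff.2 fun u _ => (Nat.prime_nth_prime _).ne_zero),
    Nat.factorization_prod (fun u _ => (Nat.prime_nth_prime _).ne_zero), Finset.card_filter]
  have h2 : (2 ^ (a.weight v - 1)).factorization (nth Nat.Prime c) = 0 := by
    rw [Nat.prime_two.factorization_pow, Finsupp.single_apply, if_neg]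
    rw [← nth_prime_zero, nth_prime_inj]
    exact hc.symm
  rw [Finsupp.add_apply, h2, zero_add, Finsupp.finsetSum_apply]
  refine Finset.sum_congr rfl fun u _ => ?_
  rw [(Nat.prime_nth_prime _).factorization, Finsupp.single_apply]
  simp only [nth_prime_inj]

theorem factorization_code_two (v : V) : (a.code v).factorization 2 + 1 = a.weight v := by
  rw [code_eq, Nat.factorization_mul (by positivity)
    (Finset.prod_ne_zero_iff.2 fun u _ => (Nat.prime_nth_prime _).ne_zero),
    Nat.factorization_prod (fun u _ => (Nat.prime_nth_prime _).ne_zero), Finsupp.add_apply,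
    Finsupp.finsetSum_apply, Finset.sum_eq_zero, Nat.prime_two.factorization_pow,
    Finsupp.single_eq_same, add_zero]
  · have := a.weight_pos v
    omega
  · intro u _
    rw [(Nat.prime_nth_prime _).factorization, Finsupp.single_apply, if_neg]
    rw [← nth_prime_zero, nth_prime_inj]
    exact a.code_ne_zero u

end

end Arbor

namespace Arbor

open MatulaCode
open Nat (nth)

/-! ### The code classifies rooted weighted trees -/

section
variable {V V' : Type*} (a : Arbor V) (a' : Arbor V')

theorem par_par_ne {v : V} (hv : v ≠ a.root) : a.par (a.par v) ≠ v := by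
  intro h
  by_cases hp : a.par v = a.root
  · rw [hp, a.par_root] at h
    exact hv h.symm
  · have h1 := a.depth_par v hv
    have h2 := a.depth_par _ hp
    rw [h] at h2
    omega

theorem map_par (e : a.toGraph.graph ≃g a'.toGraph.graph) (hr : e a.root = a'.root) (v : V) :
    e (a.par v) = a'.par (e v) := by
  refine a.par_induction (P := fun v => e (a.par v) = a'.par (e v)) ?_ (fun v hv ih => ?_) v
  · rw [a.par_root, hr, a'.par_root]
  · have h : a'.toGraph.graph.Adj (e v) (e (a.par v)) := e.map_rel_iff.2 (a.adj_par hv)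
    rcases h.2 with h | h
    · exact h.symm
    · rw [← ih, e.injective.eq_iff] at h
      exact absurd h (a.par_par_ne hv)

variable [Fintype V] [Fintype V']

theorem code_eq_of_iso (e : a.toGraph.graph ≃g a'.toGraph.graph)
    (hw : ∀ v, a'.toGraph.weight (e v) = a.toGraph.weight v) (hr : e a.root = a'.root) (v : V) :
    a'.code (e v) = a.code v := by
  refine a.eq_code (c := fun v => a'.code (e v)) (fun v => ?_) v
  have hc : a'.children (e v) = (a.children v).map e.toEquiv.toEmbedding := by
    ext u
    obtain ⟨u, rfl⟩ := e.surjective u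
    have : e u ∈ (a.children v).map e.toEquiv.toEmbedding ↔ u ∈ a.children v :=
      Finset.mem_map' e.toEquiv.toEmbedding
    rw [this, mem_children, mem_children, ← hr, ← a.map_par a' e hr, Ne, e.injective.eq_iff,
      e.injective.eq_iff]
  have hw' : a'.weight (e v) = a.weight v := hw v
  rw [a'.code_eq, hc, Finset.prod_map, hw']
  rfl

theorem card_filter_code_eq {v : V} {v' : V'} (h : a.code v = a'.code v') (c : ℕ) :
    ((a.children v).filter fun u => a.code u = c).card
      = ((a'.children v').filter fun u => a'.code u = c).card := by
  by_cases hc : c = 0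
  · subst hc
    rw [Finset.filter_false_of_mem fun u _ => a.code_ne_zero u,
      Finset.filter_false_of_mem fun u _ => a'.code_ne_zero u]
    rfl
  · rw [← a.factorization_code_nth_prime v hc, ← a'.factorization_code_nth_prime v' hc, h]

/-- Vertices with equal codes have matching children. -/
theorem exists_bijOn_children {v : V} {v' : V'} (h : a.code v = a'.code v') :
    ∃ τ : V → V', Set.BijOn τ (a.children v) (a'.children v') ∧
      ∀ u ∈ a.children v, a'.code (τ u) = a.code u := by
  classical
  let f : {u // u ∈ a.children v} → ℕ := fun u => a.code u
  let g : {u // u ∈ a'.children v'} → ℕ := fun u => a'.code u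
  have hcard : ∀ c, Fintype.card {u // f u = c} = Fintype.card {u // g u = c} := by
    intro c
    rw [Fintype.card_congr (Equiv.subtypeSubtypeEquivSubtypeInter (· ∈ a.children v)
        (a.code · = c)),
      Fintype.card_congr (Equiv.subtypeSubtypeEquivSubtypeInter (· ∈ a'.children v')
        (a'.code · = c)),
      Fintype.card_of_subtype ((a.children v).filter fun u => a.code u = c) (by simp),
      Fintype.card_of_subtype ((a'.children v').filter fun u => a'.code u = c) (by simp),
      card_filter_code_eq a a' h c]
  let e := Equiv.ofFiberEquiv fun c => Fintype.equivOfCardEq (hcard c)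
  have he : ∀ u, a'.code (e u) = a.code u := fun u =>
    Equiv.ofFiberEquiv_map (f := f) (g := g) (fun c => Fintype.equivOfCardEq (hcard c)) u
  refine ⟨fun u => if hu : u ∈ a.children v then e ⟨u, hu⟩ else v', ⟨?_, ?_, ?_⟩, ?_⟩
  · intro u hu
    have hu : u ∈ a.children v := hu
    simp only [dif_pos hu]
    exact (e ⟨u, hu⟩).2
  · intro u hu w hw huw
    have hu : u ∈ a.children v := hu
    have hw : w ∈ a.children v := hw
    simp only [dif_pos hu, dif_pos hw] at huw
    exact congrArg Subtype.val (e.injective (Subtype.ext huw))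
  · intro u hu
    have hu : u ∈ a'.children v' := hu
    refine ⟨e.symm ⟨u, hu⟩, (e.symm ⟨u, hu⟩).2, ?_⟩
    simp
  · intro u hu
    simp only [dif_pos hu]
    exact he ⟨u, hu⟩

theorem isomorphic_of_code_eq (h : a.code a.root = a'.code a'.root) :
    a.toGraph.Isomorphic a'.toGraph := by
  have : Nonempty V' := ⟨a'.root⟩
  choose! τ hτ using fun (v : V) (v' : V') => exists_bijOn_children a a' (v := v) (v' := v')
  -- Recursion on depth: `F n` matters only at vertices of depth `n`, each of which is matched with
  -- a child, of equal code, of the image of its parent.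
  let F : ℕ → V → V' := fun n => Nat.rec (fun _ => a'.root)
    (fun _ G v => τ (a.par v) (G (a.par v)) v) n
  let f : V → V' := fun v => F (a.depth v) v
  have f_root : f a.root = a'.root := by
    simp only [f, a.depth_root]
    rfl
  have f_step : ∀ v, v ≠ a.root → f v = τ (a.par v) (f (a.par v)) v := by
    intro v hv
    simp only [f, a.depth_par v hv]
    rfl
  have f_code : ∀ v, a.code v = a'.code (f v) := by
    refine a.par_induction (by rw [f_root, h]) fun v hv ih => ?_
    rw [f_step v hv, (hτ _ _ ih).2 v (a.mem_children.2 ⟨hv, rfl⟩)]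
  have f_mem : ∀ v, v ≠ a.root → f v ∈ a'.children (f (a.par v)) := by
    intro v hv
    rw [f_step v hv]
    exact (hτ _ _ (f_code _)).1.mapsTo (a.mem_children.2 ⟨hv, rfl⟩)
  have f_ne : ∀ v, v ≠ a.root → f v ≠ a'.root := fun v hv => (a'.mem_children.1 (f_mem v hv)).1
  have f_par : ∀ v, f (a.par v) = a'.par (f v) := by
    intro v
    by_cases hv : v = a.root
    · rw [hv, a.par_root, f_root, a'.par_root]
    · exact (a'.mem_children.1 (f_mem v hv)).2.symm
  have f_inj : ∀ u v, f u = f v → u = v := by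
    refine a.par_induction (fun v huv => ?_) fun u hu ih v huv => ?_
    · by_contra hv
      exact f_ne v (Ne.symm hv) (huv.symm.trans f_root)
    · have hv : v ≠ a.root := by
        rintro rfl
        exact f_ne u hu (huv.trans f_root)
      have hp : a.par u = a.par v := ih _ (by rw [f_par, f_par, huv])
      rw [f_step u hu, f_step v hv, hp] at huv
      exact (hτ _ _ (f_code _)).1.injOn (a.mem_children.2 ⟨hu, hp⟩) (a.mem_children.2 ⟨hv, rfl⟩) huv
  have f_surj : ∀ v', ∃ v, f v = v' := by
    refine a'.par_induction ⟨a.root, f_root⟩ fun v' hv' ih => ?_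
    obtain ⟨p, hp⟩ := ih
    obtain ⟨u, hu, hu'⟩ := (hτ _ _ (f_code p)).1.surjOn
      (a'.mem_children.2 ⟨hv', hp.symm⟩)
    have hu := a.mem_children.1 hu
    refine ⟨u, ?_⟩
    rw [f_step u hu.1, hu.2, hu']
  have hf : Function.Injective f := fun u v => f_inj u v
  refine ⟨⟨Equiv.ofBijective f ⟨hf, f_surj⟩, ?_⟩, fun v => ?_⟩
  · intro u v
    change (f u ≠ f v ∧ (a'.par (f u) = f v ∨ a'.par (f v) = f u)) ↔ _
    rw [← f_par, ← f_par, hf.ne_iff, hf.eq_iff, hf.eq_iff]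
    rfl
  · change a'.weight (f v) = a.weight v
    rw [← factorization_code_two, ← factorization_code_two, f_code]

end

/-! ### Every code is realized -/

section
variable {V V' : Type*} (a : Arbor V) (b : Arbor V')

open Classical in
/-- Increase the weight of the root by one. -/
noncomputable def addWeight : Arbor V :=
  { a with
    weight := fun v => a.weight v + if v = a.root then 1 else 0
    weight_pos := fun v => Nat.add_pos_left (a.weight_pos v) _ }

open Classical in
/-- Attach `b` to the root of `a` by an edge between the roots. -/
noncomputable def graft : Arbor (V ⊕ V') where
  root := Sum.inl a.root
  par := Sum.elim (fun v => Sum.inl (a.par v))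
    fun v => if v = b.root then Sum.inl a.root else Sum.inr (b.par v)
  depth := Sum.elim a.depth fun v => b.depth v + 1
  weight := Sum.elim a.weight b.weight
  par_root := by simp [a.par_root]
  depth_root := a.depth_root
  depth_par := by
    rintro (v | v) h
    · exact a.depth_par v fun hv => h (hv ▸ rfl)
    · by_cases hv : v = b.root
      · simp [hv, a.depth_root, b.depth_root]
      · simp [hv, b.depth_par v hv]
  weight_pos := by
    rintro (v | v)
    · exact a.weight_pos v
    · exact b.weight_pos v

variable [Fintype V] [Fintype V']

theorem code_addWeight_root : a.addWeight.code a.addWeight.root = 2 * a.code a.root := by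
  classical
  have h := a.addWeight.eq_code (c := fun v => if v = a.root then 2 * a.code v else a.code v)
    fun v => ?_
  · rw [← h]
    exact if_pos rfl
  · have hp : ∏ u ∈ a.addWeight.children v,
        nth Nat.Prime (if u = a.root then 2 * a.code u else a.code u)
        = ∏ u ∈ a.children v, nth Nat.Prime (a.code u) := by
      refine Finset.prod_congr ?_ fun u hu => ?_
      · ext u
        rw [mem_children, mem_children]
        rfl
      · rw [if_neg (a.mem_children.1 hu).1]
    rw [hp, a.code_eq v]
    have := a.weight_pos v
    have hw : a.addWeight.weight v = a.weight v + if v = a.root then 1 else 0 := by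
      simp only [addWeight]
    rw [hw]
    split_ifs
    · rw [← mul_assoc, ← pow_succ']
      congr 2
      omega
    · rfl

theorem code_graft_root :
    (a.graft b).code (a.graft b).root = a.code a.root * nth Nat.Prime (b.code b.root) := by
  classical
  have hpl : ∀ v, (a.graft b).par (Sum.inl v) = Sum.inl (a.par v) := fun _ => rfl
  have hpr : ∀ v, v ≠ b.root → (a.graft b).par (Sum.inr v) = Sum.inr (b.par v) := by
    intro v hv
    simp [graft, hv]
  have hpb : (a.graft b).par (Sum.inr b.root) = Sum.inl a.root := by
    simp [graft]
  have hroot : (a.graft b).root = Sum.inl a.root := rfl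
  have hcr : ∀ v, (a.graft b).children (Sum.inr v) = (b.children v).map .inr := by
    intro v
    ext (u | u)
    · simp [mem_children, hpl]
    · by_cases hu : u = b.root
      · simp [mem_children, hu, hpb]
      · simp [mem_children, hu, hpr, hroot]
  have hcl : ∀ v, (a.graft b).children (Sum.inl v)
      = (a.children v).map .inl ∪ if v = a.root then {Sum.inr b.root} else ∅ := by
    intro v
    ext (u | u)
    · by_cases hv : v = a.root <;> simp [mem_children, hpl, hroot, hv]
    · by_cases hu : u = b.root
      · by_cases hv : v = a.root
        · simp [mem_children, hu, hpb, hv, hroot]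
        · simp [mem_children, hu, hpb, hv, hroot, Ne.symm hv]
      · by_cases hv : v = a.root <;> simp [mem_children, hu, hpr, hroot, hv]
  have h := (a.graft b).eq_code (c := Sum.elim (fun v => a.code v *
    if v = a.root then nth Nat.Prime (b.code b.root) else 1) b.code) fun v => ?_
  · rw [← h]
    simp [hroot]
  · rcases v with v | v
    · have hm : ∏ u ∈ a.children v, nth Nat.Prime (a.code u *
          if u = a.root then nth Nat.Prime (b.code b.root) else 1)
          = ∏ u ∈ a.children v, nth Nat.Prime (a.code u) := by
        refine Finset.prod_congr rfl fun u hu => ?_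
        rw [if_neg (a.mem_children.1 hu).1, mul_one]
      rw [hcl, Finset.prod_union, Finset.prod_map]
      · simp only [Function.Embedding.inl_apply, Sum.elim_inl]
        rw [hm, a.code_eq v, ← mul_assoc]
        congr 1
        split_ifs <;> simp
      · split_ifs
        · simp
        · simp
    · rw [hcr, Finset.prod_map]
      exact b.code_eq v

end

/-- The tree with one vertex, of weight one. -/
def single : Arbor Unit where
  root := ()
  par := id
  depth _ := 0
  weight _ := 1
  par_root := rfl
  depth_root := rfl
  depth_par _ h := absurd rfl h
  weight_pos _ := one_pos

/-- Strip one prime factor: a factor `2` is a unit of root weight, any other prime is a branch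
grafted at the root. -/
theorem exists_code_eq {k : ℕ} (hk : k ≠ 0) :
    ∃ (V : Type) (_ : Fintype V) (a : Arbor V), a.code a.root = k := by
  induction k using Nat.strong_induction_on with
  | _ k ih =>
    by_cases h1 : k = 1
    · refine ⟨Unit, inferInstance, single, ?_⟩
      rw [h1, code_eq]
      have : single.children single.root = ∅ := by
        ext u
        simp [mem_children, single]
      rw [this]
      rfl
    obtain ⟨p, hp, m, rfl⟩ := Nat.exists_prime_and_dvd h1
    have hm : m ≠ 0 := right_ne_zero_of_mul hk
    have hp2 := hp.two_le
    have hpm : p ≤ p * m := Nat.le_mul_of_pos_right p (Nat.pos_of_ne_zero hm)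
    obtain ⟨V, hV, a, ha⟩ := ih m (by nlinarith [Nat.pos_of_ne_zero hm]) hm
    by_cases h2 : p = 2
    · refine ⟨V, hV, a.addWeight, ?_⟩
      rw [code_addWeight_root, ha, h2]
    · have hlt := primeCounting'_lt_of_mem (k := p)
        (by rw [Nat.primeFactorsList_prime hp]; exact List.mem_singleton_self p)
      obtain ⟨V', hV', b, hb⟩ := ih (Nat.primeCounting' p) (hlt.trans_le hpm)
        (by rwa [Ne, primeCounting'_eq_zero hp])
      refine ⟨V ⊕ V', inferInstance, a.graft b, ?_⟩
      rw [code_graft_root, ha, hb, nth_primeCounting' hp, mul_comm]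

end Arbor

theorem WeightedGraph.exists_weightedTree {V : Type*} [Fintype V] (W : WeightedGraph V)
    (hW : W.graph.IsTree) : ∃ T : WeightedTree, W.Isomorphic T.toGraph := by
  let e := Fintype.equivFin V
  let i : W.graph ≃g W.graph.map e.toEmbedding := SimpleGraph.Iso.map e W.graph
  refine ⟨⟨Fintype.card V, ⟨W.graph.map e.toEmbedding, fun v => W.weight (e.symm v),
    fun v => W.weight_pos _⟩, i.isTree_iff.1 hW⟩, i, fun v => ?_⟩
  change W.weight (e.symm (e v)) = _
  rw [e.symm_apply_apply]

/-! ### Exchanging the weights of pendant paths -/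

/-- A vertex `v` of `G` with a pendant path `v`, `p (0, i)`, `p (1, i)` for every `i`. -/
structure PendantPaths {V : Type*} (G : SimpleGraph V) {o : Type*} (v : V)
    (p : Fin 2 × o → V) : Prop where
  injective : Function.Injective p
  ne : ∀ x, p x ≠ v
  adj_zero : ∀ i u, G.Adj (p (0, i)) u ↔ u = v ∨ u = p (1, i)
  adj_one : ∀ i u, G.Adj (p (1, i)) u ↔ u = p (0, i)

namespace PendantPaths

variable {V : Type*} {G : SimpleGraph V} {o : Type*} {v : V} {p : Fin 2 × o → V}

open Classical in
/-- Pendant paths enter a characteristic determinant only through their total contribution at the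
vertex `v` and through the product of their own determinants. -/
theorem det_eq [Fintype V] [Fintype o] (h : PendantPaths G v p) {K : Type*} [Field K] (δ : V → K)
    (hδ : ∀ i, δ (p (0, i)) * δ (p (1, i)) - 1 ≠ 0) :
    (Matrix.diagonal δ - G.adjMatrix K).det
      = (∏ i, (δ (p (0, i)) * δ (p (1, i)) - 1)) *
        (Matrix.of fun u w : {u // u ∉ Set.range p} =>
          (Matrix.diagonal (fun u : {u // u ∉ Set.range p} => δ u) u w
            - G.adjMatrix K u w)
            - if (u : V) = v ∧ (w : V) = v then
              ∑ i, δ (p (1, i)) / (δ (p (0, i)) * δ (p (1, i)) - 1) else 0).det := by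
  -- Order the vertices with the paths first and take the Schur complement of the path block `P`,
  -- whose inverse `Q` consists of `2 × 2` adjugates over determinants. Only the entry at `v`
  -- changes, since the paths meet the rest only there.
  let σ : (Fin 2 × o) ⊕ {u // u ∉ Set.range p} ≃ V :=
    ((Equiv.ofInjective p h.injective).sumCongr (Equiv.refl _)).trans (Equiv.Set.sumCompl (Set.range p))
  have hσl : ∀ x, σ (Sum.inl x) = p x := fun _ => rfl
  have hσr : ∀ u, σ (Sum.inr u) = u.1 := fun _ => rfl
  let P : Matrix (Fin 2 × o) (Fin 2 × o) K :=
    Matrix.blockDiagonal fun i => !![δ (p (0, i)), -1; -1, δ (p (1, i))]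
  let Q : Matrix (Fin 2 × o) (Fin 2 × o) K :=
    Matrix.blockDiagonal fun i => (δ (p (0, i)) * δ (p (1, i)) - 1)⁻¹ •
      !![δ (p (1, i)), 1; 1, δ (p (0, i))]
  let B : Matrix (Fin 2 × o) {u // u ∉ Set.range p} K :=
    Matrix.of fun x u => if x.1 = 0 ∧ (u : V) = v then -1 else 0
  let D : Matrix {u // u ∉ Set.range p} {u // u ∉ Set.range p} K :=
    Matrix.of fun u w => Matrix.diagonal (fun u : {u // u ∉ Set.range p} => δ u) u w
      - G.adjMatrix K u w
  have hblock : (Matrix.diagonal δ - G.adjMatrix K).submatrix σ σ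
      = Matrix.fromBlocks P B B.transpose D := by
    have h0 : ∀ i l j, G.Adj (p (0, i)) (p (l, j)) ↔ l = 1 ∧ j = i := by
      intro i l j
      rw [h.adj_zero, or_iff_right (h.ne _), h.injective.eq_iff, Prod.mk.injEq]
    have h1 : ∀ i l j, G.Adj (p (1, i)) (p (l, j)) ↔ l = 0 ∧ j = i := by
      intro i l j
      rw [h.adj_one, h.injective.eq_iff, Prod.mk.injEq]
    have h2 : ∀ x (u : {u // u ∉ Set.range p}), G.Adj (p x) u ↔ x.1 = 0 ∧ (u : V) = v := by
      rintro ⟨k, i⟩ u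
      have hu : ∀ y, (u : V) ≠ p y := fun y hy => u.2 ⟨y, hy.symm⟩
      fin_cases k
      · simp [h.adj_zero, hu]
      · simp [h.adj_one, hu]
    have h3 : ∀ x (u : {u // u ∉ Set.range p}), p x ≠ u := fun x u hx => u.2 ⟨x, hx⟩
    ext (x | u) (y | w)
    · obtain ⟨k, i⟩ := x
      obtain ⟨l, j⟩ := y
      rw [Matrix.submatrix_apply, hσl, hσl, Matrix.fromBlocks_apply₁₁, Matrix.sub_apply,
        SimpleGraph.adjMatrix_apply, Matrix.diagonal_apply, h.injective.eq_iff, Prod.mk.injEq]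
      simp only [P, Matrix.blockDiagonal_apply]
      by_cases hij : i = j
      · subst hij
        fin_cases k <;> fin_cases l <;> simp [h0, h1]
      · fin_cases k <;> simp [h0, h1, hij, Ne.symm hij]
    · rw [Matrix.submatrix_apply, hσl, hσr, Matrix.fromBlocks_apply₁₂, Matrix.sub_apply,
        SimpleGraph.adjMatrix_apply, Matrix.diagonal_apply_ne _ (h3 x w)]
      simp only [B, Matrix.of_apply, h2]
      split_ifs <;> simp
    · rw [Matrix.submatrix_apply, hσl, hσr, Matrix.fromBlocks_apply₂₁, Matrix.sub_apply,
        SimpleGraph.adjMatrix_apply, Matrix.diagonal_apply_ne _ (h3 y u).symm]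
      simp only [B, Matrix.of_apply, Matrix.transpose_apply, G.adj_comm (u : V), h2]
      split_ifs <;> simp
    · rw [Matrix.submatrix_apply, hσr, hσr, Matrix.fromBlocks_apply₂₂, Matrix.sub_apply]
      simp only [D, Matrix.of_apply, Matrix.diagonal_apply, Subtype.ext_iff]
  have hPQ : P * Q = 1 := by
    rw [← Matrix.blockDiagonal_mul, ← Matrix.blockDiagonal_one]
    congr 1
    funext i
    have := hδ i
    ext a b
    fin_cases a <;> fin_cases b <;> simp [Matrix.mul_apply, Fin.sum_univ_two] <;> field_simp <;> ring
  let _ : Invertible P := ⟨Q, mul_eq_one_comm.1 hPQ, hPQ⟩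
  have hinv : ⅟P = Q := rfl
  rw [← Matrix.det_submatrix_equiv_self σ, hblock, Matrix.det_fromBlocks₁₁, hinv,
    Matrix.det_blockDiagonal]
  congr 1
  · refine Finset.prod_congr rfl fun i _ => ?_
    rw [Matrix.det_fin_two_of]
    ring
  · congr 1
    ext u w
    rw [Matrix.sub_apply]
    simp only [Matrix.of_apply, D]
    congr 1
    rw [Matrix.mul_apply]
    have h4 : ∀ y, (B.transpose * Q) u y
        = if (u : V) = v then -(δ (p (0, y.2)) * δ (p (1, y.2)) - 1)⁻¹ *
          (if y.1 = 0 then δ (p (1, y.2)) else 1) else 0 := by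
      rintro ⟨l, j⟩
      rw [Matrix.mul_apply, Fintype.sum_prod_type, Fin.sum_univ_two]
      by_cases hu : (u : V) = v
      · fin_cases l <;> simp [B, Q, Matrix.blockDiagonal_apply, hu]
      · simp [B, hu]
    rw [Finset.sum_congr rfl fun y _ => by rw [h4 y], Fintype.sum_prod_type, Fin.sum_univ_two]
    by_cases hu : (u : V) = v
    · by_cases hw : (w : V) = v
      · simp [B, hu, hw, div_eq_inv_mul]
      · simp [B, hw]
    · simp [hu]

end PendantPaths

/-! ### Two interchangeable triples of path weights -/

namespace WeightedGraph

variable {V : Type*}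

open Classical in
/-- The weighted graph with the weights of the vertices `p x` replaced by `b x`. -/
noncomputable def reweight (W : WeightedGraph V) {ι : Type*} (p : ι → V) (b : ι → ℕ)
    (hb : ∀ x, 0 < b x) : WeightedGraph V where
  graph := W.graph
  weight := Function.extend p b W.weight
  weight_pos u := by
    by_cases h : ∃ x, p x = u
    · rw [Function.extend_def, dif_pos h]
      exact hb _
    · rw [Function.extend_apply' _ _ _ h]
      exact W.weight_pos u

open Classical in
theorem map_charPoly [Fintype V] (W : WeightedGraph V) {K : Type*} [CommRing K] (f : ℤ[X] →+* K) :
    f W.charPoly = (Matrix.diagonal (fun u => f X ^ W.weight u)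
      - W.graph.adjMatrix K).det := by
  rw [charPoly, RingHom.map_det, RingHom.mapMatrix_apply, Matrix.map_sub _ (map_sub f),
    Matrix.diagonal_map (map_zero f)]
  congr 2
  · simp
  · ext u w
    rw [Matrix.map_apply, SimpleGraph.adjMatrix_apply, SimpleGraph.adjMatrix_apply]
    split_ifs <;> simp

/-- The weights of three pendant paths, first next to the attaching vertex, then at the leaves. -/
def pathWeight (x : Fin 2 × Fin 3) : ℕ := ![![2, 4, 1], ![1, 2, 5]] x.1 x.2

/-- Weights of pendant paths that may replace `pathWeight`. -/
def pathWeight' (x : Fin 2 × Fin 3) : ℕ := ![![5, 2, 1], ![1, 4, 2]] x.1 x.2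

theorem pathWeight_pos : ∀ x, 0 < pathWeight x := by decide

theorem pathWeight'_pos : ∀ x, 0 < pathWeight' x := by decide

/-- Over the denominator `t ^ 6 - 1` both sides have the numerator `t + t ^ 2 + t ^ 4 + t ^ 5`. -/
theorem sum_pathWeight {K : Type*} [Field K] {t : K} (h3 : t ^ 3 - 1 ≠ 0) (h6 : t ^ 6 - 1 ≠ 0) :
    t / (t ^ 6 - 1) + t ^ 4 / (t ^ 6 - 1) + t ^ 2 / (t ^ 3 - 1)
      = t / (t ^ 3 - 1) + t ^ 2 / (t ^ 6 - 1) + t ^ 5 / (t ^ 6 - 1) := by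
  have e : t ^ 6 - 1 = (t ^ 3 - 1) * (t ^ 3 + 1) := by ring
  have h4 : t ^ 3 + 1 ≠ 0 := fun h0 => h6 (by rw [e, h0, mul_zero])
  rw [e]
  field_simp
  ring

theorem charPoly_reweight [Fintype V] {W : WeightedGraph V} {v : V}
    {p : Fin 2 × Fin 3 → V} (h : PendantPaths W.graph v p)
    (hw : ∀ x, W.weight (p x) = pathWeight x) :
    (W.reweight p pathWeight' pathWeight'_pos).charPoly = W.charPoly := by
  classical
  -- The Schur complement divides by the path determinants `t ^ n - 1`. Both triples have `n = 3, 6,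
  -- 6` in some order, so the products agree.
  let K := FractionRing ℤ[X]
  let f : ℤ[X] →+* K := algebraMap ℤ[X] K
  have hf : Function.Injective f := IsFractionRing.injective ℤ[X] K
  apply hf
  set t : K := f X with ht
  have hX : ∀ n, 0 < n → t ^ n - 1 ≠ 0 := by
    intro n hn h0
    rw [sub_eq_zero, ht, ← map_pow, ← map_one f] at h0
    have := congrArg (Polynomial.eval 0) (hf h0)
    simp [hn.ne'] at this
  have hw' : ∀ x, (W.reweight p pathWeight' pathWeight'_pos).weight (p x) = pathWeight' x :=
    fun x => h.injective.extend_apply _ _ x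
  have hr : ∀ u, u ∉ Set.range p →
      (W.reweight p pathWeight' pathWeight'_pos).weight u = W.weight u :=
    fun u hu => Function.extend_apply' _ _ _ hu
  have hg : (W.reweight p pathWeight' pathWeight'_pos).graph = W.graph := rfl
  rw [map_charPoly, map_charPoly, hg, ← ht]
  have e3 := hX 3 (by norm_num)
  have e6 := hX 6 (by norm_num)
  rw [h.det_eq, h.det_eq]
  · congr 1
    · simp only [hw, hw', ← pow_add, Fin.prod_univ_three]
      simp [pathWeight, pathWeight']
      ring
    · congr 1
      ext u w
      simp only [Matrix.of_apply, Matrix.diagonal_apply, hr u u.2]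
      congr 2
      simp only [hw, hw', ← pow_add, Fin.sum_univ_three]
      simp [pathWeight, pathWeight']
      exact sum_pathWeight e3 e6
  · intro i
    rw [hw, hw, ← pow_add]
    exact hX _ (Nat.add_pos_left (pathWeight_pos _) _)
  · intro i
    rw [hw', hw', ← pow_add]
    exact hX _ (Nat.add_pos_left (pathWeight'_pos _) _)

/-- The invariant is the number of leaves of weight 1 whose neighbour has weight 2. The new paths
contain no such leaf, while the old path (2,1) does. -/
theorem not_isomorphic_reweight [Finite V] {W : WeightedGraph V} {v : V}
    {p : Fin 2 × Fin 3 → V} (h : PendantPaths W.graph v p)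
    (hw : ∀ x, W.weight (p x) = pathWeight x) :
    ¬ (W.reweight p pathWeight' pathWeight'_pos).Isomorphic W := by
  let L : WeightedGraph V → Set V := fun W => {d | W.weight d = 1 ∧
    ∃ c, W.weight c = 2 ∧ ∀ u, W.graph.Adj d u ↔ u = c}
  set W' := W.reweight p pathWeight' pathWeight'_pos
  rintro ⟨e, he⟩
  have hw' : ∀ x, W'.weight (p x) = pathWeight' x := fun x => h.injective.extend_apply _ _ x
  have hr : ∀ u, u ∉ Set.range p → W'.weight u = W.weight u :=
    fun u hu => Function.extend_apply' _ _ _ hu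
  have himage : e '' L W' = L W := by
    ext d
    obtain ⟨d, rfl⟩ := e.surjective d
    rw [e.injective.mem_set_image]
    change (W'.weight d = 1 ∧ ∃ c, W'.weight c = 2 ∧ ∀ u, W'.graph.Adj d u ↔ u = c) ↔
      (W.weight (e d) = 1 ∧ ∃ c, W.weight c = 2 ∧ ∀ u, W.graph.Adj (e d) u ↔ u = c)
    rw [e.surjective.exists (p := fun c => W.weight c = 2 ∧ ∀ u, W.graph.Adj (e d) u ↔ u = c), he]
    refine and_congr_right fun _ => exists_congr fun c => ?_
    rw [he, e.surjective.forall (p := fun u => W.graph.Adj (e d) u ↔ u = e c)]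
    exact and_congr_right fun _ => forall_congr' fun u =>
      iff_congr e.map_rel_iff.symm e.injective.eq_iff.symm
  have hsub : L W' ⊂ L W := by
    refine ⟨?_, fun hLW => ?_⟩
    · rintro d ⟨hd, c, hc, hdc⟩
      have hne : p (0, 0) ≠ p (0, 1) := fun h0 => by
        have := h.injective h0
        simp at this
      have hdr : d ∉ Set.range p := by
        rintro ⟨⟨k, i⟩, rfl⟩
        fin_cases k
        · have h1 := (hdc v).1 ((h.adj_zero i v).2 (Or.inl rfl))
          have h2 := (hdc (p (1, i))).1 ((h.adj_zero i _).2 (Or.inr rfl))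
          exact h.ne _ (h2.trans h1.symm)
        · have h1 := (hdc (p (0, i))).1 ((h.adj_one i _).2 rfl)
          rw [← h1, hw'] at hc
          rw [hw'] at hd
          fin_cases i <;> simp [pathWeight'] at hc hd
      have hcr : c ∉ Set.range p := by
        rintro ⟨⟨k, i⟩, rfl⟩
        have hadj : W.graph.Adj (p (k, i)) d := ((hdc _).2 rfl).symm
        fin_cases k
        -- Here the leaf `d` would be `v`, which has several neighbours `p (0, i)`.
        · rcases (h.adj_zero i d).1 hadj with rfl | rfl
          · have h1 := (hdc (p (0, 0))).1 ((h.adj_zero 0 d).2 (Or.inl rfl)).symm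
            have h2 := (hdc (p (0, 1))).1 ((h.adj_zero 1 d).2 (Or.inl rfl)).symm
            exact hne (h1.trans h2.symm)
          · exact hdr ⟨_, rfl⟩
        · exact hdr ⟨_, ((h.adj_one i d).1 hadj).symm⟩
      exact ⟨(hr d hdr).symm.trans hd, c, (hr c hcr).symm.trans hc, hdc⟩
    · have h1 : p (1, 0) ∈ L W :=
        ⟨hw _, p (0, 0), hw _, fun u => h.adj_one 0 u⟩
      obtain ⟨_, c, hc, hcu⟩ := hLW h1
      have h2 := (hcu (p (0, 0))).1 ((h.adj_one 0 _).2 rfl)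
      rw [← h2, hw'] at hc
      simp [pathWeight'] at hc
  have h1 := Set.ncard_lt_ncard hsub
  rw [← himage, Set.ncard_image_of_injective _ e.injective] at h1
  exact lt_irrefl _ h1

end WeightedGraph

/-! ### Reading pendant paths off the code -/

namespace Arbor

open MatulaCode
open Nat (nth primeFactorsList)
open WeightedGraph (pathWeight pathWeight_pos pathWeight' pathWeight'_pos)

variable {V : Type*} [Fintype V] (a : Arbor V)

theorem adj_iff_of_ne_root {v u : V} (hv : v ≠ a.root) :
    a.toGraph.graph.Adj v u ↔ u = a.par v ∨ u ∈ a.children v := by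
  rw [adj_iff, mem_children]
  constructor
  · rintro ⟨hne, h | h⟩
    · exact Or.inl h.symm
    · refine Or.inr ⟨?_, h⟩
      rintro rfl
      exact hne (h.symm.trans a.par_root)
  · rintro (rfl | ⟨hu, h⟩)
    · exact ⟨(a.par_ne hv).symm, Or.inl rfl⟩
    · refine ⟨?_, Or.inr h⟩
      rintro rfl
      exact a.par_ne hu h

theorem nth_prime_dvd_code {u v : V} (h : u ∈ a.children v) :
    nth Nat.Prime (a.code u) ∣ a.code v := by
  rw [a.code_eq v]
  exact Dvd.dvd.mul_left (Finset.dvd_prod_of_mem (fun u => nth Nat.Prime (a.code u)) h) _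

theorem exists_mem_children {v : V} {c : ℕ} (hc : c ≠ 0) (h : nth Nat.Prime c ∣ a.code v) :
    ∃ u ∈ a.children v, a.code u = c := by
  have h1 := ((Nat.prime_nth_prime c).dvd_iff_one_le_factorization (a.code_ne_zero v)).1 h
  rw [a.factorization_code_nth_prime v hc] at h1
  obtain ⟨u, hu⟩ := Finset.card_pos.1 h1
  exact ⟨u, Finset.mem_filter.1 hu⟩

theorem not_nth_prime_dvd_two_pow {c : ℕ} (hc : c ≠ 0) (m : ℕ) : ¬ nth Nat.Prime c ∣ 2 ^ m := by
  intro h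
  have h1 := (Nat.prime_dvd_prime_iff_eq (Nat.prime_nth_prime c) Nat.prime_two).1
    ((Nat.prime_nth_prime c).dvd_of_dvd_pow h)
  rw [← nth_prime_zero, nth_prime_inj] at h1
  exact hc h1

theorem of_code_eq_two_pow {v : V} {m : ℕ} (h : a.code v = 2 ^ m) :
    a.weight v = m + 1 ∧ a.children v = ∅ := by
  constructor
  · rw [← factorization_code_two, h, Nat.prime_two.factorization_pow, Finsupp.single_eq_same]
  · refine Finset.eq_empty_of_forall_notMem fun u hu => ?_
    have := a.nth_prime_dvd_code hu
    rw [h] at this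
    exact not_nth_prime_dvd_two_pow (a.code_ne_zero u) m this

theorem of_code_eq_two_pow_mul {v : V} {m c : ℕ} (hc : c ≠ 0)
    (h : a.code v = 2 ^ m * nth Nat.Prime c) :
    a.weight v = m + 1 ∧ ∃ u, a.code u = c ∧ a.children v = {u} := by
  have hfac : (a.code v).factorization = Finsupp.single 2 m + Finsupp.single (nth Nat.Prime c) 1 := by
    rw [h, Nat.factorization_mul (by positivity) (Nat.prime_nth_prime c).ne_zero,
      Nat.prime_two.factorization_pow, (Nat.prime_nth_prime c).factorization]
  have hne : 2 ≠ nth Nat.Prime c := by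
    rw [← nth_prime_zero, Ne, nth_prime_inj]
    exact hc.symm
  constructor
  · rw [← factorization_code_two, hfac, Finsupp.add_apply, Finsupp.single_eq_same,
      Finsupp.single_apply, if_neg hne.symm, add_zero]
  · have h1 := a.factorization_code_nth_prime v hc
    rw [hfac, Finsupp.add_apply, Finsupp.single_eq_same, Finsupp.single_apply, if_neg hne,
      zero_add] at h1
    have h2 : (a.children v).filter (fun u => a.code u = c) = a.children v := by
      refine Finset.filter_true_of_mem fun u hu => ?_
      have := a.nth_prime_dvd_code hu
      rw [h, (Nat.prime_nth_prime _).dvd_mul] at this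
      rcases this with h3 | h3
      · exact absurd h3 (not_nth_prime_dvd_two_pow (a.code_ne_zero u) m)
      · rw [Nat.prime_dvd_prime_iff_eq (Nat.prime_nth_prime _) (Nat.prime_nth_prime _),
          nth_prime_inj] at h3
        exact h3
    rw [h2] at h1
    obtain ⟨u, hu⟩ := Finset.card_eq_one.1 h1.symm
    have hu' : u ∈ (a.children v).filter (fun u => a.code u = c) := by
      rw [h2, hu]
      exact Finset.mem_singleton_self u
    exact ⟨u, (Finset.mem_filter.1 hu').2, hu⟩

theorem pathWeight_zero_injective : Function.Injective fun i => pathWeight (0, i) := by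
  decide

/-- The code of the `i`-th path with weights `pathWeight`. -/
noncomputable def pathCode (i : Fin 3) : ℕ :=
  2 ^ (pathWeight (0, i) - 1) * nth Nat.Prime (2 ^ (pathWeight (1, i) - 1))

/-- A node whose code is a multiple of `limbCode` has the three paths among its branches. -/
noncomputable def limbCode : ℕ := ∏ i, nth Nat.Prime (pathCode i)

theorem limbCode_ne_zero : limbCode ≠ 0 :=
  Finset.prod_ne_zero_iff.2 fun _ _ => (Nat.prime_nth_prime _).ne_zero

theorem pathCode_ne_zero (i : Fin 3) : pathCode i ≠ 0 :=
  mul_ne_zero (by positivity) (Nat.prime_nth_prime _).ne_zero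

theorem exists_pendantPaths {v : V} (h : limbCode ∣ a.code v) :
    ∃ p : Fin 2 × Fin 3 → V, PendantPaths a.toGraph.graph v p ∧
      ∀ x, a.weight (p x) = pathWeight x := by
  have h1 : ∀ i, ∃ u ∈ a.children v, a.code u = pathCode i := fun i =>
    a.exists_mem_children (pathCode_ne_zero i)
      ((Finset.dvd_prod_of_mem (fun i => nth Nat.Prime (pathCode i)) (Finset.mem_univ i)).trans h)
  choose c hc hcode using h1
  have h2 : ∀ i, a.weight (c i) = pathWeight (0, i) ∧
      ∃ u, a.code u = 2 ^ (pathWeight (1, i) - 1) ∧ a.children (c i) = {u} := by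
    intro i
    have := a.of_code_eq_two_pow_mul (by positivity) (hcode i)
    rwa [Nat.sub_add_cancel (pathWeight_pos (0, i))] at this
  choose hcw d hd hcd using h2
  have h3 : ∀ i, a.weight (d i) = pathWeight (1, i) ∧ a.children (d i) = ∅ := by
    intro i
    have := a.of_code_eq_two_pow (hd i)
    rwa [Nat.sub_add_cancel (pathWeight_pos (1, i))] at this
  have hdc : ∀ i, d i ∈ a.children (c i) := fun i => by
    rw [hcd]
    exact Finset.mem_singleton_self _
  have hcv := fun i => a.depth_of_mem_children (hc i)
  have hdv := fun i => a.depth_of_mem_children (hdc i)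
  have hc' := fun i => a.mem_children.1 (hc i)
  have hd' := fun i => a.mem_children.1 (hdc i)
  -- The weights 2, 4, 1 next to `v` differ, so the three branches do; depth separates the two
  -- levels of the paths from each other and from `v`.
  have hcinj : Function.Injective c := by
    intro i j hij
    have h4 : pathWeight (0, i) = pathWeight (0, j) := by rw [← hcw, ← hcw, hij]
    exact pathWeight_zero_injective h4
  refine ⟨fun x => if x.1 = 0 then c x.2 else d x.2, ⟨?_, ?_, ?_, ?_⟩, ?_⟩
  · rintro ⟨k, i⟩ ⟨l, j⟩ hkl
    fin_cases k <;> fin_cases l <;> simp at hkl ⊢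
    · exact hcinj hkl
    · have e1 := hcv i
      have e2 := hdv j
      have e3 := hcv j
      rw [hkl] at e1
      omega
    · have e1 := hcv j
      have e2 := hdv i
      have e3 := hcv i
      rw [← hkl] at e1
      omega
    · refine hcinj ?_
      rw [← (hd' i).2, ← (hd' j).2, hkl]
  · rintro ⟨k, i⟩ hv
    have e1 := hcv i
    have e2 := hdv i
    fin_cases k
    · simp only [Fin.zero_eta, if_true] at hv
      rw [hv] at e1
      omega
    · simp only [Fin.mk_one, one_ne_zero, if_false] at hv
      rw [hv] at e2
      omega
  · intro i u
    simp only [if_true]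
    rw [a.adj_iff_of_ne_root (hc' i).1, (hc' i).2, hcd, Finset.mem_singleton]
    simp
  · intro i u
    simp only [if_true]
    rw [if_neg (by decide), a.adj_iff_of_ne_root (hd' i).1, (hd' i).2, (h3 i).2]
    simp
  · rintro ⟨k, i⟩
    fin_cases k
    · simpa using hcw i
    · simpa using (h3 i).1

/-- A tree in which no node has a code divisible by `q` has a code avoiding `q`. -/
theorem avoids_code {q : ℕ} (h : ∀ v, ¬ q ∣ a.code v) (v : V) : Avoids q (a.code v) := by
  refine a.children_induction (P := fun v => Avoids q (a.code v)) (fun v ih => ?_) v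
  rw [avoids_iff]
  refine ⟨h v, fun p hp => ?_⟩
  have hpp := Nat.prime_of_mem_primeFactorsList hp
  by_cases h2 : p = 2
  · exact Or.inl h2
  · right
    obtain ⟨u, hu, hcode⟩ := a.exists_mem_children (v := v) (c := Nat.primeCounting' p)
      (by rwa [Ne, primeCounting'_eq_zero hpp])
      (by rw [nth_primeCounting' hpp]; exact Nat.dvd_of_mem_primeFactorsList hp)
    rw [← hcode]
    exact ih u hu

end Arbor

/-! ### Counting weighted free trees -/

namespace WeightedFreeTree

open MatulaCode Arbor
open WeightedGraph (pathWeight pathWeight_pos pathWeight' pathWeight'_pos)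

theorem exists_cospectral_ne {T : WeightedTree} {v : Fin T.order} {p : Fin 2 × Fin 3 → Fin T.order}
    (h : PendantPaths T.toGraph.graph v p) (hw : ∀ x, T.toGraph.weight (p x) = pathWeight x) :
    ∃ s : WeightedFreeTree, s ≠ Quotient.mk _ T ∧ s.Cospectral (Quotient.mk _ T) := by
  refine ⟨Quotient.mk _ ⟨T.order, T.toGraph.reweight p pathWeight' pathWeight'_pos, T.isTree⟩,
    fun heq => ?_, ?_⟩
  · exact WeightedGraph.not_isomorphic_reweight h hw (Quotient.exact heq)
  · exact WeightedGraph.charPoly_reweight h hw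

theorem mk_out (t : WeightedFreeTree) : (Quotient.mk _ (Quotient.out t) : WeightedFreeTree) = t :=
  Quotient.out_eq t

theorem totalWeight_out (t : WeightedFreeTree) :
    (Quotient.out t).toGraph.totalWeight = t.totalWeight := by
  conv_rhs => rw [← mk_out t]
  rfl

theorem exists_arbor (T : WeightedTree) : ∃ a : Arbor (Fin T.order), a.toGraph = T.toGraph := by
  obtain ⟨r⟩ := T.isTree.connected.nonempty
  obtain ⟨a, _, ha⟩ := exists_of_isTree T.toGraph T.isTree r
  exact ⟨a, ha⟩

/-- Root every free tree arbitrarily: without a mate, no node has a code divisible by `limbCode`,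
and the code determines the tree. -/
theorem ncard_diff_withMate_le (n : ℕ) :
    (ofWeight n \ withMate n).ncard ≤ (avoiding limbCode n).card := by
  choose a ha using exists_arbor
  let f : WeightedFreeTree → ℕ := fun t => (a t.out).code (a t.out).root
  rw [← Set.ncard_coe_finset]
  refine Set.ncard_le_ncard_of_injOn f ?_ ?_ (Finset.finite_toSet _)
  · rintro t ⟨ht, hmate⟩
    rw [Finset.mem_coe, mem_avoiding]
    constructor
    · refine (a t.out).avoids_code (fun v hv => hmate ⟨ht, ?_⟩) _
      obtain ⟨p, hp, hw⟩ := (a t.out).exists_pendantPaths hv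
      have hw' : ∀ x, (a t.out).toGraph.weight (p x) = pathWeight x := hw
      rw [ha] at hp hw'
      have := exists_cospectral_ne hp hw'
      rwa [mk_out] at this
    · rw [treeSize_code_root, ha, totalWeight_out]
      exact ht
  · intro s _ t _ hst
    have h := isomorphic_of_code_eq (a s.out) (a t.out) hst
    rw [ha, ha] at h
    rw [← mk_out s, ← mk_out t]
    exact Quotient.sound h

/-- Realizing the code on the chosen representative makes all rootings of one free tree live on the
same vertex set. -/
theorem exists_arbor_out {k : ℕ} (hk : k ≠ 0) :
    ∃ t : WeightedFreeTree, ∃ b : Arbor (Fin (Quotient.out t).order),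
      b.toGraph = (Quotient.out t).toGraph ∧ b.code b.root = k := by
  obtain ⟨V, hV, a, ha⟩ := exists_code_eq hk
  obtain ⟨T, e, he⟩ := a.toGraph.exists_weightedTree a.isTree
  obtain ⟨e', he'⟩ := Setoid.symm (Quotient.mk_out T)
  obtain ⟨b, hb, hbT⟩ := exists_of_isTree (Quotient.out (Quotient.mk _ T)).toGraph
    (Quotient.out (Quotient.mk _ T)).isTree (e' (e a.root))
  refine ⟨Quotient.mk _ T, b, hbT, ?_⟩
  have h : ∃ i : a.toGraph.graph ≃g b.toGraph.graph,
      (∀ v, b.toGraph.weight (i v) = a.toGraph.weight v) ∧ i a.root = b.root := by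
    rw [hbT, hb]
    exact ⟨e.trans e', fun v => (he' (e v)).trans (he v), rfl⟩
  obtain ⟨i, hi, hr⟩ := h
  rw [← ha, ← a.code_eq_of_iso b i hi hr, hr]

theorem code_root_congr {V : Type*} [Fintype V] {a b : Arbor V} (hg : a.toGraph = b.toGraph)
    (hr : a.root = b.root) : a.code a.root = b.code b.root := by
  have h : ∃ i : a.toGraph.graph ≃g b.toGraph.graph,
      (∀ v, b.toGraph.weight (i v) = a.toGraph.weight v) ∧ i a.root = b.root := by
    rw [hg, hr]
    exact ⟨RelIso.refl _, fun _ => rfl, rfl⟩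
  obtain ⟨i, hi, hi'⟩ := h
  rw [← a.code_eq_of_iso b i hi hi', hi']

theorem card_avoiding_zero_le (n : ℕ) : (avoiding 0 n).card ≤ n * (ofWeight n).ncard := by
  classical
  have : Nonempty WeightedFreeTree := ⟨(exists_arbor_out one_ne_zero).choose⟩
  choose! t ht using fun (k : ℕ) (hk : k ≠ 0) => exists_arbor_out hk
  rw [Set.ncard_eq_toFinset_card _ (finite_ofWeight n)]
  refine Finset.card_le_mul_card_image_of_maps_to (f := t) (fun k hk => ?_) n fun s hs => ?_
  · rw [mem_avoiding_zero] at hk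
    obtain ⟨b, hb, hcode⟩ := ht k hk.1
    rw [Set.Finite.mem_toFinset]
    change (t k).totalWeight = n
    rw [← totalWeight_out, ← hb, ← treeSize_code_root, hcode, hk.2]
  · rw [Set.Finite.mem_toFinset] at hs
    have hs' : s.totalWeight = n := hs
    have horder : (Quotient.out s).order ≤ n := by
      rw [← hs', ← totalWeight_out]
      have := Finset.card_nsmul_le_sum Finset.univ (Quotient.out s).toGraph.weight 1
        fun v _ => (Quotient.out s).toGraph.weight_pos v
      simpa [WeightedGraph.totalWeight] using this
    -- The codes sent to `s` are those of rootings of one fixed tree. The root determines the code,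
    -- and there are at most `n` vertices since weights are positive.
    have hroot : ∀ k ∈ {k ∈ avoiding 0 n | t k = s}, ∃ r, ∃ b : Arbor (Fin (Quotient.out s).order),
        b.root = r ∧ b.toGraph = (Quotient.out s).toGraph ∧ b.code b.root = k := by
      intro k hk
      rw [Finset.mem_filter, mem_avoiding_zero] at hk
      obtain ⟨⟨hk, _⟩, rfl⟩ := hk
      obtain ⟨b, hb⟩ := ht k hk
      exact ⟨b.root, b, rfl, hb⟩
    have : Nonempty (Fin (Quotient.out s).order) := (Quotient.out s).isTree.connected.nonempty
    choose! r hr using hroot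
    refine le_trans ?_ horder
    rw [← Fintype.card_fin (Quotient.out s).order, ← Finset.card_univ]
    refine Finset.card_le_card_of_injOn r (fun _ _ => Finset.mem_coe.2 (Finset.mem_univ _)) ?_
    intro k hk l hl hkl
    obtain ⟨b, hbr, hb, hbk⟩ := hr k hk
    obtain ⟨c, hcr, hc, hcl⟩ := hr l hl
    rw [← hbk, ← hcl]
    exact code_root_congr (hb.trans hc.symm) (by rw [hbr, hcr, hkl])

theorem ncard_ofWeight_pos {n : ℕ} (hn : 0 < n) : 0 < (ofWeight n).ncard :=
  pos_of_mul_pos_right ((card_avoiding_zero_pos hn).trans_le (card_avoiding_zero_le n))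
    (Nat.zero_le n)

theorem tendsto_ncard_diff_div :
    Tendsto (fun n : ℕ => ((ofWeight n \ withMate n).ncard : ℝ) / (ofWeight n).ncard)
      atTop (𝓝 0) := by
  refine squeeze_zero' (Eventually.of_forall fun n => by positivity) ?_
    (tendsto_card_avoiding_div limbCode_ne_zero)
  filter_upwards [eventually_gt_atTop 0] with n hn
  have h1 : ((ofWeight n \ withMate n).ncard : ℝ) ≤ (avoiding limbCode n).card := by
    exact_mod_cast ncard_diff_withMate_le n
  have h2 : ((avoiding 0 n).card : ℝ) ≤ n * (ofWeight n).ncard := by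
    exact_mod_cast card_avoiding_zero_le n
  have h3 : (0 : ℝ) < (avoiding 0 n).card := by exact_mod_cast card_avoiding_zero_pos hn
  have h4 : (0 : ℝ) < (ofWeight n).ncard := by exact_mod_cast ncard_ofWeight_pos hn
  rw [div_le_div_iff₀ h4 h3]
  calc ((ofWeight n \ withMate n).ncard : ℝ) * (avoiding 0 n).card
      ≤ (avoiding limbCode n).card * (n * (ofWeight n).ncard) := by gcongr
    _ = n * (avoiding limbCode n).card * (ofWeight n).ncard := by ring

end WeightedFreeTree

theorem mainTheorem2 :
    Tendsto
      (fun n : ℕ =>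
        ((WeightedFreeTree.withMate n).ncard : ℝ) / ((WeightedFreeTree.ofWeight n).ncard : ℝ))
      atTop (𝓝 1) := by
  have h := WeightedFreeTree.tendsto_ncard_diff_div.const_sub 1
  rw [sub_zero] at h
  refine h.congr' ?_
  filter_upwards [eventually_gt_atTop 0] with n hn
  have h1 := Set.ncard_sdiff_add_ncard_of_subset
    (show WeightedFreeTree.withMate n ⊆ WeightedFreeTree.ofWeight n from fun _ ht => ht.1)
    (WeightedFreeTree.finite_ofWeight n)
  have h2 : ((WeightedFreeTree.ofWeight n).ncard : ℝ) ≠ 0 := by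
    exact_mod_cast (WeightedFreeTree.ncard_ofWeight_pos hn).ne'
  rw [eq_div_iff h2, sub_mul, one_mul, div_mul_cancel₀ _ h2, ← h1]
  push_cast
  ring
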